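/- A $4$-graph is a finite hypergraph all of whose edges are $4$-element sets of vertices. For a family $\mathcal F$ of $4$-graphs, a $4$-graph is $\mathcal F$-free if it contains no member of $\mathcal F$ as a (not necessarily induced) sub-hypergraph; $\mathrm{ex}(n,\mathcal F)$ is the maximum number of edges of an $\mathcal F$-free $4$-graph on $n$ vertices, and $\pi(\mathcal F)=\lim_{n\to\infty}\mathrm{ex}(n,\mathcal F)/\binom n4$. Let $P=(\{1,2\},\{\{1,1,2,2\}\})$; a $4$-graph $H$ is $P$-colorable if there is a map $\phi:V(H)\to\{1,2\}$ such that every edge has exactly two vertices with $\phi=1$ and exactly two with $\phi=2$, and $\mathrm{Col}(P)$ is the class of all $P$-colorable $4$-graphs. For a $4$-graph $G$ with vertex set $\{1,\dots,n\}$ and a real number $\alpha>1$ let $$\lambda_\alpha(G)=\max\Big\{4!\sum_{\{i_1,i_2,i_3,i_4\}\in E(G)}x_{i_1}x_{i_2}x_{i_3}x_{i_4}\ :\ x\in\mathbb R^n,\ \Big(\sum_{i=1}^n|x_i|^\alpha\Big)^{1/\alpha}=1\Big\}.$$ Let $B_4(n)$ be the $4$-graph whose vertex set is the disjoint union of two parts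 of sizes $\lfloor n/2\rfloor$ and $\lceil n/2\rceil$ and whose edges are all $4$-sets with exactly two vertices in each part. **Theorem.** Let $\mathcal F$ be a family of $4$-graphs such that (i) $(\mathcal F,P)$ is a Turán pair: every $P$-colorable $4$-graph is $\mathcal F$-free, and for all sufficiently large $n$ every $\mathcal F$-free $4$-graph on $n$ vertices with $\mathrm{ex}(n,\mathcal F)$ edges is $P$-colorable; and (ii) $\mathcal F$ is degree-stable with respect to $\mathrm{Col}(P)$: there exist $\varepsilon>0$ and $n_1$ such that every $\mathcal F$-free $4$-graph $H$ on $n\ge n_1$ vertices with minimum degree $\delta(H)\ge(\pi(\mathcal F)/3!-\varepsilon)n^{3}$ is $P$-colorable. Then for every $\alpha>1$ there exists $n_0$ such that every $\mathcal F$-free $4$-graph $G$ on $n>n_0$ vertices satisfies $\lambda_\alpha(G)\le\lambda_\alpha(B_4(n))$, with equality if and only if $G$ is isomorphic to $B_4(n)$. -/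

import Mathlib

open Filter Topology

/-- A (finite, simple) `k`-graph on the vertex type `V`: a finite set of edges, each of which is a
set of exactly `k` vertices. -/
@[ext]
structure KGraph (k : ℕ) (V : Type*) where
  edges : Finset (Finset V)
  uniform : ∀ e ∈ edges, e.card = k

namespace KGraph

variable {k : ℕ} {V W : Type*}

/-- `H` contains a copy of `F` as a (not necessarily induced) sub-hypergraph. -/
def Contains (H : KGraph k V) (F : KGraph k W) : Prop :=
  ∃ f : W ↪ V, ∀ e ∈ F.edges, e.map f ∈ H.edges

/-- Isomorphism of `k`-graphs. -/
def Iso (G : KGraph k V) (H : KGraph k W) : Prop :=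
  ∃ f : V ≃ W, ∀ e : Finset V, e ∈ G.edges ↔ e.map f.toEmbedding ∈ H.edges

/-- The degree of a vertex: the number of edges containing it. -/
def degree [DecidableEq V] (H : KGraph k V) (v : V) : ℕ :=
  (H.edges.filter (fun e => v ∈ e)).card

/-- The minimum degree. -/
noncomputable def minDegree [DecidableEq V] (H : KGraph k V) : ℕ :=
  ⨅ v : V, H.degree v

/-- The Lagrangian polynomial `P_G(x) = k! ∑_{e ∈ E(G)} ∏_{v ∈ e} x_v`. -/
noncomputable def lagrangian (G : KGraph k V) (x : V → ℝ) : ℝ :=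
  (Nat.factorial k : ℝ) * ∑ e ∈ G.edges, ∏ v ∈ e, x v

/-- The `α`-spectral radius: the maximum of the Lagrangian polynomial over the unit sphere of the
`ℓ_α`-norm. (For `α ≥ 1` and `V` finite and nonempty the sphere is compact and nonempty, so that
the supremum is a maximum.) -/
noncomputable def spectralRadius [Fintype V] (α : ℝ) (G : KGraph k V) : ℝ :=
  sSup (G.lagrangian '' {x : V → ℝ | (∑ v, |x v| ^ α) ^ (1 / α) = 1})

end KGraph

/-- Families (or classes) of finite `k`-graphs. Every finite `k`-graph is isomorphic to one on some
`Fin n`. -/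
abbrev KFamily (k : ℕ) := Set (Σ n : ℕ, KGraph k (Fin n))

/-- `H` is `𝓕`-free: it contains no member of `𝓕`. -/
def KGraph.Free {k : ℕ} {V : Type*} (H : KGraph k V) (𝓕 : KFamily k) : Prop :=
  ∀ F ∈ 𝓕, ¬ H.Contains F.2

/-- The Turán number `ex(n, 𝓕)`: the maximum number of edges of an `𝓕`-free `k`-graph on `n`
vertices. -/
noncomputable def turanNumber {k : ℕ} (n : ℕ) (𝓕 : KFamily k) : ℕ :=
  sSup {m : ℕ | ∃ H : KGraph k (Fin n), H.Free 𝓕 ∧ H.edges.card = m}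

/-- The Turán density `π(𝓕) = lim ex(n, 𝓕) / (n choose k)`. -/
noncomputable def turanDensity {k : ℕ} (𝓕 : KFamily k) : ℝ :=
  limUnder atTop (fun n : ℕ => (turanNumber n 𝓕 : ℝ) / (n.choose k : ℝ))

/-- A `k`-pattern `([l], E)`: a collection `E` of `k`-multisets with elements from a set of
`l ≥ 1` colors. -/
structure KPattern (k : ℕ) where
  l : ℕ
  pos : 0 < l
  edges : Set (Multiset (Fin l))
  uniform : ∀ s ∈ edges, Multiset.card s = k

/-- `H` is `P`-colorable: there is a homomorphism from `H` to the pattern `P`. -/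
def KGraph.Colorable {k : ℕ} {V : Type*} (H : KGraph k V) (P : KPattern k) : Prop :=
  ∃ φ : V → Fin P.l, ∀ e ∈ H.edges, e.val.map φ ∈ P.edges

/-- `Col(P)`, the class of all `P`-colorable `k`-graphs. -/
def KPattern.Col {k : ℕ} (P : KPattern k) : KFamily k :=
  {H | H.2.Colorable P}

/-- `(𝓕, P)` is a Turán pair: every `P`-colorable `k`-graph is `𝓕`-free and, for all sufficiently
large `n`, every `𝓕`-free `k`-graph on `n` vertices with the maximum number of edges is
`P`-colorable. (Requiring the second part for all `n` would give a more restrictive notion.) -/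
def IsTuranPair {k : ℕ} (𝓕 : KFamily k) (P : KPattern k) : Prop :=
  (∀ (n : ℕ) (H : KGraph k (Fin n)), H.Colorable P → H.Free 𝓕) ∧
  ∃ n₀ : ℕ, ∀ n ≥ n₀, ∀ H : KGraph k (Fin n),
    H.Free 𝓕 → H.edges.card = turanNumber n 𝓕 → H.Colorable P

/-- `𝓕` is degree-stable with respect to the class `ℌ`. -/
def IsDegreeStable {k : ℕ} (𝓕 ℌ : KFamily k) : Prop :=
  ∃ ε : ℝ, 0 < ε ∧ ∃ n₀ : ℕ, ∀ n ≥ n₀, ∀ H : KGraph k (Fin n), H.Free 𝓕 →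
    (turanDensity 𝓕 / (Nat.factorial (k - 1) : ℝ) - ε) * (n : ℝ) ^ (k - 1) ≤ (H.minDegree : ℝ) →
    (⟨n, H⟩ : Σ n : ℕ, KGraph k (Fin n)) ∈ ℌ

/-- The `4`-pattern `({1,2}, {{1,1,2,2}})`; the two colors are called `0` and `1` here. -/
def patternB4 : KPattern 4 where
  l := 2
  pos := by decide
  edges := {({0, 0, 1, 1} : Multiset (Fin 2))}
  uniform := by
    intro s hs
    rw [Set.mem_singleton_iff.mp hs]
    rfl

/-- `B₄(n)`, the complete balanced bipartite-like `4`-graph on `n` vertices: the parts are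
`{v | v < ⌊n/2⌋}` and its complement, and the edges are all `4`-sets with exactly two vertices in
each part. -/
def B4 (n : ℕ) : KGraph 4 (Fin n) where
  edges := Finset.univ.filter (fun e : Finset (Fin n) =>
    (e.filter (fun v => v.val < n / 2)).card = 2 ∧
    (e.filter (fun v => ¬ v.val < n / 2)).card = 2)
  uniform := by
    intro e he
    have h := (Finset.mem_filter.mp he).2
    rw [← Finset.card_filter_add_card_filter_not (s := e) (fun v => v.val < n / 2), h.1, h.2]

/-! Complete split graphs are handled directly. On parts of sizes `a`, `b` the Lagrangian is a
product of two second elementary symmetric polynomials. Cauchy–Schwarz, power means and `p * q ≤ 1 /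
4` for the `α`-masses `p`, `q` of the parts give its exact maximum, a function of `n` and `t = a *
b` that increases in `t`. Hence colorable graphs satisfy the bound, and equality at a strictly
positive maximizer forces the balanced complete split graph.

For a general free `G` whose spectral radius is at least the extremal value `b_n` (`balancedValue α
n`), take a nonnegative maximizer `x`. If every `x v ^ α` is at least `(1 - δ) / n`, the first-order
condition makes every link sum nearly `n ^ 3 / 16`. Since the weights are then nearly equal, link
sums approximate degrees, and degree stability (with `π / 3! = 1 / 16`) makes `G` colorable:
`exists_colorable_of_le_weights`. Otherwise some vertex is light, and deleting it multiplies the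
ratio of spectral radius to extremal value by at least `1 + c / n`:
`exists_colorable_or_deleteVertex`.

The ratio is bounded at a fixed order `N`, while repeated deletions from order `n` would force gains
adding up to a tail of the harmonic series. So for large `n` the ratio is at most `1`. In the
equality case a deletion would push the ratio at order `n - 1` above `1`; hence `G` is colorable
with a positive maximizer. -/

namespace KGraph

/-! ### The Lagrangian and its maximizers -/

variable {k : ℕ} {V W : Type*}

theorem lagrangian_le_lagrangian_abs (G : KGraph k V) (x : V → ℝ) :
    G.lagrangian x ≤ G.lagrangian (fun v => |x v|) := by
  unfold lagrangian
  refine mul_le_mul_of_nonneg_left (Finset.sum_le_sum fun e _ => ?_) (Nat.cast_nonneg _)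
  rw [← Finset.abs_prod]
  exact le_abs_self _

theorem lagrangian_nonneg (G : KGraph k V) {x : V → ℝ} (hx : ∀ v, 0 ≤ x v) :
    0 ≤ G.lagrangian x :=
  mul_nonneg (Nat.cast_nonneg _)
    (Finset.sum_nonneg fun _ _ => Finset.prod_nonneg fun i _ => hx i)

theorem lagrangian_const_mul (G : KGraph k V) (c : ℝ) (x : V → ℝ) :
    G.lagrangian (fun v => c * x v) = c ^ k * G.lagrangian x := by
  unfold lagrangian
  rw [mul_left_comm, Finset.mul_sum (a := c ^ k)]
  congr 1
  refine Finset.sum_congr rfl fun e he => ?_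
  rw [Finset.prod_mul_distrib, Finset.prod_const, G.uniform e he]

theorem continuous_lagrangian (G : KGraph k V) : Continuous G.lagrangian := by
  unfold lagrangian
  fun_prop

section Sphere

variable [Fintype V] {α : ℝ}

theorem rpow_one_div_eq_one_iff (hα : 0 < α) (x : V → ℝ) :
    (∑ v, |x v| ^ α) ^ (1 / α) = 1 ↔ ∑ v, |x v| ^ α = 1 := by
  have h0 : 0 ≤ ∑ v, |x v| ^ α := Finset.sum_nonneg fun v _ => by positivity
  rw [← Real.rpow_left_inj h0 zero_le_one (z := 1 / α) (by positivity), Real.one_rpow]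

theorem isCompact_sphere (hα : 0 < α) :
    IsCompact {x : V → ℝ | (∑ v, |x v| ^ α) ^ (1 / α) = 1} := by
  simp_rw [rpow_one_div_eq_one_iff hα]
  refine Metric.isCompact_of_isClosed_isBounded ?_ ?_
  · refine isClosed_eq ?_ continuous_const
    exact continuous_finsetSum _ fun v _ =>
      ((continuous_apply v).abs).rpow_const fun _ => Or.inr hα.le
  · refine (Metric.isBounded_closedBall (x := (0 : V → ℝ)) (r := 1)).subset fun x hx => ?_
    rw [mem_closedBall_zero_iff, pi_norm_le_iff_of_nonneg zero_le_one]
    intro v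
    have h : |x v| ^ α ≤ 1 := by
      rw [← show ∑ v, |x v| ^ α = 1 from hx]
      exact Finset.single_le_sum (f := fun v => |x v| ^ α) (fun v _ => by positivity)
        (Finset.mem_univ v)
    rw [Real.norm_eq_abs]
    by_contra hlt
    exact absurd h (not_le.mpr (Real.one_lt_rpow (not_le.mp hlt) hα))

/-- The `α`-spectral radius is attained at a nonnegative vector. -/
theorem exists_maximizer [Nonempty V] (hα : 0 < α) (G : KGraph k V) :
    ∃ x : V → ℝ, (∀ v, 0 ≤ x v) ∧ ∑ v, x v ^ α = 1 ∧ G.lagrangian x = G.spectralRadius α := by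
  classical
  have hne : {x : V → ℝ | (∑ v, |x v| ^ α) ^ (1 / α) = 1}.Nonempty := by
    obtain ⟨v⟩ := ‹Nonempty V›
    refine ⟨Pi.single v 1, ?_⟩
    rw [Set.mem_ofPred_eq, rpow_one_div_eq_one_iff hα, Finset.sum_eq_single v]
    · simp
    · intro w _ hw
      simp [Pi.single_eq_of_ne hw, Real.zero_rpow hα.ne']
    · simp
  obtain ⟨x, hx, hmax⟩ := (isCompact_sphere hα).exists_isMaxOn hne
    G.continuous_lagrangian.continuousOn
  have hx1 : (fun v => |x v|) ∈ {x : V → ℝ | (∑ v, |x v| ^ α) ^ (1 / α) = 1} := by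
    simpa using hx
  have hle : ∀ y ∈ {x : V → ℝ | (∑ v, |x v| ^ α) ^ (1 / α) = 1},
      G.lagrangian y ≤ G.lagrangian (fun v => |x v|) := fun y hy =>
    (hmax hy).trans (G.lagrangian_le_lagrangian_abs x)
  refine ⟨fun v => |x v|, fun v => abs_nonneg _, (rpow_one_div_eq_one_iff hα x).mp hx, ?_⟩
  refine (IsGreatest.csSup_eq ⟨Set.mem_image_of_mem _ hx1, ?_⟩).symm
  rintro _ ⟨y, hy, rfl⟩
  exact hle y hy

theorem lagrangian_le_spectralRadius (hα : 0 < α) (G : KGraph k V) {x : V → ℝ}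
    (hx : ∀ v, 0 ≤ x v) (hx1 : ∑ v, x v ^ α = 1) : G.lagrangian x ≤ G.spectralRadius α := by
  refine le_csSup ((isCompact_sphere hα).image G.continuous_lagrangian).bddAbove
    (Set.mem_image_of_mem _ ?_)
  rw [Set.mem_ofPred_eq, rpow_one_div_eq_one_iff hα]
  simpa only [abs_of_nonneg (hx _)] using hx1

theorem spectralRadius_le [Nonempty V] (hα : 0 < α) (G : KGraph k V) {C : ℝ}
    (h : ∀ x : V → ℝ, (∀ v, 0 ≤ x v) → ∑ v, x v ^ α = 1 → G.lagrangian x ≤ C) :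
    G.spectralRadius α ≤ C := by
  obtain ⟨x, hx, hx1, hxe⟩ := G.exists_maximizer hα
  exact hxe ▸ h x hx hx1

theorem spectralRadius_nonneg [Nonempty V] (hα : 0 < α) (G : KGraph k V) :
    0 ≤ G.spectralRadius α := by
  obtain ⟨x, hx, hx1, hxe⟩ := G.exists_maximizer hα
  exact hxe ▸ G.lagrangian_nonneg hx

/-- Homogeneous form of the definition of the spectral radius. -/
theorem lagrangian_le_mul_rpow [Nonempty V] (hα : 0 < α) (hk : k ≠ 0) (G : KGraph k V)
    {x : V → ℝ} (hx : ∀ v, 0 ≤ x v) :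
    G.lagrangian x ≤ G.spectralRadius α * (∑ v, x v ^ α) ^ ((k : ℝ) / α) := by
  have hs0 : 0 ≤ ∑ v, x v ^ α := Finset.sum_nonneg fun v _ => Real.rpow_nonneg (hx v) _
  rcases hs0.eq_or_lt with hs | hs
  · have hx0 : ∀ v, x v = 0 := fun v => by
      have := (Finset.sum_eq_zero_iff_of_nonneg
        (fun v _ => Real.rpow_nonneg (hx v) α)).mp hs.symm v (Finset.mem_univ v)
      exact (Real.rpow_eq_zero (hx v) hα.ne').mp this
    have : G.lagrangian x = 0 := by
      unfold lagrangian
      rw [Finset.sum_eq_zero, mul_zero]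
      intro e he
      obtain ⟨v, hv⟩ := Finset.card_ne_zero.mp ((G.uniform e he).symm ▸ hk)
      exact Finset.prod_eq_zero hv (hx0 v)
    rw [this]
    exact mul_nonneg (G.spectralRadius_nonneg hα) (Real.rpow_nonneg hs0 _)
  · set s := ∑ v, x v ^ α with hsdef
    set c := s ^ (1 / α) with hc
    have hc0 : 0 < c := Real.rpow_pos_of_pos hs _
    have hcα : c ^ α = s := by
      rw [hc, ← Real.rpow_mul hs0, one_div_mul_cancel hα.ne', Real.rpow_one]
    have hck : c ^ k = s ^ ((k : ℝ) / α) := by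
      rw [hc, ← Real.rpow_natCast, ← Real.rpow_mul hs0]
      congr 1
      ring
    have h1 : ∑ v, (c⁻¹ * x v) ^ α = 1 := by
      have : ∀ v, (c⁻¹ * x v) ^ α = s⁻¹ * x v ^ α := fun v => by
        rw [Real.mul_rpow (by positivity) (hx v), Real.inv_rpow hc0.le, hcα]
      simp_rw [this]
      rw [← Finset.mul_sum, ← hsdef, inv_mul_cancel₀ hs.ne']
    have h2 := G.lagrangian_le_spectralRadius hα
      (x := fun v => c⁻¹ * x v) (fun v => mul_nonneg (by positivity) (hx v)) h1
    rw [lagrangian_const_mul] at h2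
    rw [← hck]
    calc G.lagrangian x = (c⁻¹ ^ k * G.lagrangian x) * c ^ k := by
          rw [mul_right_comm, ← mul_pow, inv_mul_cancel₀ hc0.ne', one_pow, one_mul]
      _ ≤ _ := by gcongr

end Sphere

/-- Isomorphic `k`-graphs have the same spectral radius. -/
theorem Iso.spectralRadius_eq [Fintype V] [Fintype W] {G : KGraph k V} {H : KGraph k W}
    (h : G.Iso H) (α : ℝ) : G.spectralRadius α = H.spectralRadius α := by
  classical
  obtain ⟨f, hf⟩ := h
  have hL : ∀ x : W → ℝ, G.lagrangian (x ∘ f) = H.lagrangian x := fun x => by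
    unfold lagrangian
    congr 1
    refine Finset.sum_bij (fun e _ => e.map f.toEmbedding) (fun e he => (hf e).mp he)
      (fun a _ b _ hab => Finset.map_injective _ hab) (fun e he => ?_) (fun e he => ?_)
    · refine ⟨e.map f.symm.toEmbedding, ?_, ?_⟩
      · rw [hf]
        simpa [Finset.map_map] using he
      · simp [Finset.map_map]
    · simp [Finset.prod_map]
  unfold spectralRadius
  congr 1
  ext r
  constructor
  · rintro ⟨x, hx, rfl⟩
    refine ⟨x ∘ f.symm, ?_, ?_⟩
    · rw [Set.mem_ofPred_eq] at hx ⊢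
      rw [← Equiv.sum_comp f.symm (fun v => |x v| ^ α)] at hx
      exact hx
    · rw [← hL]
      congr 1
      ext v
      simp
  · rintro ⟨x, hx, rfl⟩
    refine ⟨x ∘ f, ?_, hL x⟩
    rw [Set.mem_ofPred_eq] at hx ⊢
    rw [← Equiv.sum_comp f (fun v => |x v| ^ α)] at hx
    exact hx

/-! ### First-order condition at a maximizer -/

section Link

variable [DecidableEq V]

/-- The sum, over the edges `e` through `v`, of the weight products over `e \ {v}`. -/
noncomputable def linkSum (G : KGraph k V) (x : V → ℝ) (v : V) : ℝ :=
  ∑ e ∈ G.edges with v ∈ e, ∏ u ∈ e.erase v, x u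

/-- An edge contains `v` at most once, so the polynomial is affine in each coordinate, with slope
given by the link. -/
theorem lagrangian_update (G : KGraph k V) (x : V → ℝ) (v : V) (s : ℝ) :
    G.lagrangian (Function.update x v s) =
      G.lagrangian x + (s - x v) * ((Nat.factorial k : ℝ) * G.linkSum x v) := by
  have h : ∀ y : V → ℝ, (∀ u, u ≠ v → y u = x u) → G.lagrangian y =
      (Nat.factorial k : ℝ) * (y v * G.linkSum x v + ∑ e ∈ G.edges with v ∉ e, ∏ u ∈ e, x u) := by
    intro y hy
    unfold lagrangian linkSum
    rw [← Finset.sum_filter_add_sum_filter_not G.edges (fun e => v ∈ e), Finset.mul_sum]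
    congr 2
    · refine Finset.sum_congr rfl fun e he => ?_
      rw [← Finset.mul_prod_erase e y (Finset.mem_filter.mp he).2]
      congr 1
      exact Finset.prod_congr rfl fun u hu => hy u (Finset.ne_of_mem_erase hu)
    · refine Finset.sum_congr rfl fun e he => Finset.prod_congr rfl fun u hu => hy u ?_
      rintro rfl
      exact (Finset.mem_filter.mp he).2 hu
  rw [h _ (fun u hu => Function.update_of_ne hu _ _), h x fun _ _ => rfl, Function.update_self]
  ring

theorem sum_update_rpow [Fintype V] (x : V → ℝ) (v : V) (s α : ℝ) :
    ∑ u, Function.update x v s u ^ α = ∑ u, x u ^ α + (s ^ α - x v ^ α) := by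
  rw [← Finset.add_sum_erase _ _ (Finset.mem_univ v),
    ← Finset.add_sum_erase _ (fun u => x u ^ α) (Finset.mem_univ v), Function.update_self,
    Finset.sum_congr rfl fun u hu => by rw [Function.update_of_ne (Finset.ne_of_mem_erase hu)]]
  ring

/-- The Lagrange multiplier equation at a maximizer. -/
theorem mul_linkSum_eq [Fintype V] {α : ℝ} (hα : 0 < α) (hk : k ≠ 0) (G : KGraph k V)
    {x : V → ℝ} (hx : ∀ v, 0 ≤ x v) (hx1 : ∑ v, x v ^ α = 1)
    (hmax : G.lagrangian x = G.spectralRadius α) (v : V) :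
    x v * ((Nat.factorial k : ℝ) * G.linkSum x v) = k * G.spectralRadius α * x v ^ α := by
  have : Nonempty V := ⟨v⟩
  set lam := G.spectralRadius α
  set y := x v ^ α
  set s := x v * ((Nat.factorial k : ℝ) * G.linkSum x v) with hs
  -- The coordinate `x v` is scaled by `t`. The homogeneous inequality removes the norm constraint,
  -- and equality holds at `t = 1`, so the derivatives of both sides agree there. This also covers
  -- `x v = 0`.
  have key : ∀ t : ℝ, 0 ≤ t → lam + (t - 1) * s ≤ lam * (1 + (t ^ α - 1) * y) ^ ((k : ℝ) / α) := by
    intro t ht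
    have h := G.lagrangian_le_mul_rpow hα hk (x := Function.update x v (t * x v)) (fun u => by
      by_cases huv : u = v
      · subst huv
        rw [Function.update_self]
        exact mul_nonneg ht (hx u)
      · rw [Function.update_of_ne huv]
        exact hx u)
    rw [lagrangian_update, sum_update_rpow, hx1, hmax, Real.mul_rpow ht (hx v)] at h
    convert h using 2
    · rw [hs]; ring
    · congr 1
      change 1 + (t ^ α - 1) * y = 1 + (t ^ α * y - y)
      ring
  have hmin : IsLocalMin (fun t : ℝ => lam * (1 + (t ^ α - 1) * y) ^ ((k : ℝ) / α) -
      (lam + (t - 1) * s)) 1 := by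
    filter_upwards [lt_mem_nhds (zero_lt_one (α := ℝ))] with t ht
    have := key t ht.le
    simp only [Real.one_rpow, sub_self, zero_mul, add_zero, mul_one]
    linarith
  have h1 : HasDerivAt (fun t : ℝ => 1 + (t ^ α - 1) * y) (α * y) 1 := by
    have := (((Real.hasDerivAt_rpow_const (x := 1) (p := α)
      (Or.inl one_ne_zero)).sub_const 1).mul_const y).const_add 1
    simpa using this
  have h2 := ((h1.rpow_const (p := (k : ℝ) / α) (Or.inl (by simp))).const_mul lam).sub
    ((((hasDerivAt_id (1 : ℝ)).sub_const 1).mul_const s).const_add lam)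
  have h3 := hmin.hasDerivAt_eq_zero h2
  simp only [Real.one_rpow, sub_self, zero_mul, add_zero, mul_one, one_mul] at h3
  have h4 : lam * (α * y * (k / α)) = k * lam * y := by
    field_simp
  linarith

end Link

end KGraph

/-! ### Vertex deletion, and link sums against degrees -/

namespace KGraph

/-- The `k`-graph induced on the vertices other than `v`. -/
def deleteVertex {k m : ℕ} (G : KGraph k (Fin (m + 1))) (v : Fin (m + 1)) : KGraph k (Fin m) where
  edges := Finset.univ.filter fun e => e.map (Fin.succAboveEmb v) ∈ G.edges
  uniform e he := by
    rw [← G.uniform _ (Finset.mem_filter.mp he).2, Finset.card_map]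

theorem Free.deleteVertex {k m : ℕ} {G : KGraph k (Fin (m + 1))} {𝓕 : KFamily k} (h : G.Free 𝓕)
    (v : Fin (m + 1)) : (G.deleteVertex v).Free 𝓕 := by
  rintro F hF ⟨f, hf⟩
  refine h F hF ⟨f.trans (Fin.succAboveEmb v), fun e he => ?_⟩
  rw [← Finset.map_map]
  exact (Finset.mem_filter.mp (hf e he)).2

theorem lagrangian_deleteVertex {k m : ℕ} (G : KGraph k (Fin (m + 1))) (v : Fin (m + 1))
    (x : Fin (m + 1) → ℝ) :
    (G.deleteVertex v).lagrangian (fun u => x (v.succAbove u)) =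
      G.lagrangian (Function.update x v 0) := by
  unfold lagrangian
  congr 1
  rw [← Finset.sum_filter_add_sum_filter_not G.edges (fun e => v ∈ e),
    Finset.sum_eq_zero (s := G.edges.filter fun e => v ∈ e), zero_add]
  · refine Finset.sum_bij (fun e _ => e.map (Fin.succAboveEmb v)) (fun e he => ?_)
      (fun a _ b _ hab => Finset.map_injective _ hab) (fun e he => ?_) (fun e he => ?_)
    · rw [Finset.mem_filter]
      refine ⟨(Finset.mem_filter.mp he).2, ?_⟩
      simp [Fin.succAbove_ne]
    · obtain ⟨heG, hv⟩ := Finset.mem_filter.mp he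
      have : (e.preimage v.succAbove (Fin.succAbove_right_injective.injOn)).map
          (Fin.succAboveEmb v) = e := by
        ext u
        simp only [Finset.mem_map, Finset.mem_preimage, Fin.succAboveEmb_apply]
        constructor
        · rintro ⟨w, hw, rfl⟩
          exact hw
        · intro hu
          obtain ⟨w, rfl⟩ := Fin.exists_succAbove_eq (x := u) (y := v) (by rintro rfl; exact hv hu)
          exact ⟨w, hu, rfl⟩
      exact ⟨_, by simpa [deleteVertex, this] using heG, this⟩
    · rw [Finset.prod_map]
      refine Finset.prod_congr rfl fun u _ => ?_
      rw [Fin.succAboveEmb_apply, Function.update_of_ne (Fin.succAbove_ne v u)]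
  · intro e he
    exact Finset.prod_eq_zero (Finset.mem_filter.mp he).2 (Function.update_self _ _ _)

/-- Deleting a vertex of small weight does not decrease the spectral radius by much. -/
theorem spectralRadius_mul_le_deleteVertex {k m : ℕ} {α : ℝ} (hα : 0 < α) (hk : k ≠ 0)
    (hm : 0 < m) (G : KGraph k (Fin (m + 1))) {x : Fin (m + 1) → ℝ} (hx : ∀ v, 0 ≤ x v)
    (hx1 : ∑ v, x v ^ α = 1) (hmax : G.lagrangian x = G.spectralRadius α) (v : Fin (m + 1)) :
    G.spectralRadius α * (1 - k * x v ^ α) ≤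
      (G.deleteVertex v).spectralRadius α * (1 - x v ^ α) ^ ((k : ℝ) / α) := by
  have : Nonempty (Fin m) := ⟨⟨0, hm⟩⟩
  have h := (G.deleteVertex v).lagrangian_le_mul_rpow hα hk (x := fun u => x (v.succAbove u))
    (fun u => hx _)
  have hs : ∑ u, x (v.succAbove u) ^ α = 1 - x v ^ α := by
    rw [← hx1, Fin.sum_univ_succAbove _ v]
    ring
  rw [lagrangian_deleteVertex, lagrangian_update, hs, hmax] at h
  have h2 := G.mul_linkSum_eq hα hk hx hx1 hmax v
  linarith

/-- A crude bound for the link sum in terms of the degree, sharp when the weights are close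
to `1`. -/
theorem linkSum_le_degree_add {k n : ℕ} (G : KGraph (k + 1) (Fin n)) {w M : Fin n → ℝ}
    (hw : ∀ v, 0 ≤ w v) (hwM : ∀ v, w v ≤ M v) (hM : ∀ v, 1 ≤ M v) (v : Fin n) :
    G.linkSum w v ≤ G.degree v + ((∑ u, M u) ^ k - (n : ℝ) ^ k) := by
  set S := G.edges.filter fun e => v ∈ e with hS
  have hcard : ∀ e ∈ S, (e.erase v).card = k := fun e he => by
    obtain ⟨he, hv⟩ := Finset.mem_filter.mp he
    rw [Finset.card_erase_of_mem hv, G.uniform e he, Nat.add_sub_cancel]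
  have h1 : G.linkSum w v ≤ G.degree v + ∑ e ∈ S, (∏ u ∈ e.erase v, M u - 1) := by
    rw [Finset.sum_sub_distrib]
    have : G.linkSum w v ≤ ∑ e ∈ S, ∏ u ∈ e.erase v, M u :=
      Finset.sum_le_sum fun e _ => Finset.prod_le_prod (fun u _ => hw u) fun u _ => hwM u
    simp only [degree, Finset.sum_const, nsmul_eq_mul, mul_one]
    linarith
  refine h1.trans (add_le_add le_rfl ?_)
  -- Every `k`-tuple contributes a nonnegative excess because `M ≥ 1`. The edges through `v` inject
  -- into tuples by listing `e \ {v}` in increasing order, so their total excess is at most this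
  -- sum.
  have h2 : (∑ u, M u) ^ k - (n : ℝ) ^ k = ∑ p : Fin k → Fin n, (∏ i, M (p i) - 1) := by
    rw [Finset.sum_sub_distrib, ← Fintype.sum_pow]
    simp
  rw [h2, ← Finset.sum_attach]
  have hinj : Function.Injective
      fun e : S => ((e.1.erase v).orderEmbOfFin (hcard e.1 e.2) : Fin k → Fin n) := by
    intro e f hef
    have h3 : (e.1.erase v : Set (Fin n)) = f.1.erase v := by
      rw [← Finset.range_orderEmbOfFin _ (hcard e.1 e.2),
        ← Finset.range_orderEmbOfFin _ (hcard f.1 f.2)]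
      exact congrArg Set.range hef
    rw [Finset.coe_inj] at h3
    apply Subtype.ext
    rw [← Finset.insert_erase (Finset.mem_filter.mp e.2).2, h3,
      Finset.insert_erase (Finset.mem_filter.mp f.2).2]
  calc ∑ e ∈ S.attach, (∏ u ∈ e.1.erase v, M u - 1)
      = ∑ e ∈ S.attach, (∏ i, M ((e.1.erase v).orderEmbOfFin (hcard e.1 e.2) i) - 1) := by
        refine Finset.sum_congr rfl fun e _ => ?_
        congr 1
        conv_lhs => rw [← Finset.map_orderEmbOfFin_univ (e.1.erase v) (hcard e.1 e.2)]
        rw [Finset.prod_map]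
        rfl
    _ = ∑ p ∈ S.attach.map ⟨_, hinj⟩, (∏ i, M (p i) - 1) := by
        rw [Finset.sum_map]
        rfl
    _ ≤ _ := Finset.sum_le_sum_of_subset_of_nonneg (Finset.subset_univ _) fun p _ _ =>
        sub_nonneg.mpr (Finset.one_le_prod fun i _ => hM _)

end KGraph

/-! ### Complete split graphs and their Lagrangian -/

/-- Twice the second elementary symmetric polynomial. -/
theorem two_mul_sum_powersetCard_two {V : Type*} [DecidableEq V] (A : Finset V) (x : V → ℝ) :
    2 * ∑ s ∈ A.powersetCard 2, ∏ v ∈ s, x v = (∑ v ∈ A, x v) ^ 2 - ∑ v ∈ A, x v ^ 2 := by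
  induction A using Finset.induction_on with
  | empty => rw [Finset.powersetCard_eq_empty.mpr (by simp)]; simp
  | insert a A ha ih =>
    rw [Finset.powersetCard_succ_insert ha, Finset.sum_union, mul_add, ih, Finset.sum_image,
      Finset.sum_insert ha, Finset.sum_insert ha, Finset.powersetCard_one, Finset.sum_map]
    · have : ∑ v ∈ A, ∏ u ∈ insert a ((⟨_, Finset.singleton_injective⟩ : V ↪ Finset V) v), x u
          = x a * ∑ v ∈ A, x v := by
        rw [Finset.mul_sum]
        refine Finset.sum_congr rfl fun v hv => ?_
        have hav : a ≠ v := by rintro rfl; exact ha hv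
        simp [Finset.prod_pair hav]
      rw [this]
      ring
    · intro s hs t ht hst
      have has : a ∉ s := fun h => ha ((Finset.mem_powersetCard.mp hs).1 h)
      have hat : a ∉ t := fun h => ha ((Finset.mem_powersetCard.mp ht).1 h)
      rw [← Finset.erase_insert has, hst, Finset.erase_insert hat]
    · rw [Finset.disjoint_left]
      intro s hs hs'
      obtain ⟨t, _, rfl⟩ := Finset.mem_image.mp hs'
      exact ha ((Finset.mem_powersetCard.mp hs).1 (Finset.mem_insert_self _ _))

namespace KGraph

variable {V : Type*} [Fintype V] [DecidableEq V]

/-- The complete `4`-graph of all `4`-sets with two vertices in `A` and two outside `A`. -/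
def completeSplit (A : Finset V) : KGraph 4 V where
  edges := Finset.univ.filter fun e => (e ∩ A).card = 2 ∧ (e \ A).card = 2
  uniform e he := by
    obtain ⟨h1, h2⟩ := (Finset.mem_filter.mp he).2
    rw [← Finset.card_inter_add_card_sdiff e A, h1, h2]

theorem mem_completeSplit {A e : Finset V} :
    e ∈ (completeSplit A).edges ↔ (e ∩ A).card = 2 ∧ (e \ A).card = 2 := by
  simp [completeSplit]

/-- An edge is an independent choice of a pair inside `A` and a pair outside. -/
theorem sum_completeSplit (A : Finset V) (x : V → ℝ) :
    ∑ e ∈ (completeSplit A).edges, ∏ v ∈ e, x v =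
      (∑ s ∈ A.powersetCard 2, ∏ v ∈ s, x v) * ∑ s ∈ Aᶜ.powersetCard 2, ∏ v ∈ s, x v := by
  rw [Finset.sum_mul_sum, ← Finset.sum_product']
  refine Finset.sum_nbij' (fun e => (e ∩ A, e \ A)) (fun p => p.1 ∪ p.2) ?_ ?_ ?_ ?_ ?_
  · intro e he
    rw [mem_completeSplit] at he
    simp only [Finset.mem_product, Finset.mem_powersetCard, he, and_true]
    exact ⟨Finset.inter_subset_right, fun v hv => by
      rw [Finset.mem_compl]; exact (Finset.mem_sdiff.mp hv).2⟩
  · rintro ⟨s, t⟩ hst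
    simp only [Finset.mem_product, Finset.mem_powersetCard] at hst
    obtain ⟨⟨hs, hs2⟩, ht, ht2⟩ := hst
    have ht' := (disjoint_compl_left (a := A)).mono_left ht
    rw [mem_completeSplit]
    have h1 : (s ∪ t) ∩ A = s := by
      rw [Finset.union_inter_distrib_right, Finset.inter_eq_left.mpr hs,
        Finset.disjoint_iff_inter_eq_empty.mp ht', Finset.union_empty]
    have h2 : (s ∪ t) \ A = t := by
      rw [Finset.union_sdiff_distrib, Finset.sdiff_eq_empty_iff_subset.mpr hs,
        Finset.empty_union, Finset.sdiff_eq_self_of_disjoint ht']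
    exact ⟨by rw [h1, hs2], by rw [h2, ht2]⟩
  · intro e _
    ext v
    simp only [Finset.mem_union, Finset.mem_inter, Finset.mem_sdiff]
    tauto
  · rintro ⟨s, t⟩ hst
    simp only [Finset.mem_product, Finset.mem_powersetCard] at hst
    obtain ⟨⟨hs, hs2⟩, ht, ht2⟩ := hst
    have ht' := (disjoint_compl_left (a := A)).mono_left ht
    rw [Finset.union_inter_distrib_right, Finset.inter_eq_left.mpr hs,
      Finset.disjoint_iff_inter_eq_empty.mp ht', Finset.union_empty,
      Finset.union_sdiff_distrib, Finset.sdiff_eq_empty_iff_subset.mpr hs,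
      Finset.empty_union, Finset.sdiff_eq_self_of_disjoint ht']
  · intro e _
    rw [← Finset.prod_inter_mul_prod_sdiff e A]

theorem lagrangian_completeSplit (A : Finset V) (x : V → ℝ) :
    (completeSplit A).lagrangian x =
      6 * ((∑ v ∈ A, x v) ^ 2 - ∑ v ∈ A, x v ^ 2) *
        ((∑ v ∈ Aᶜ, x v) ^ 2 - ∑ v ∈ Aᶜ, x v ^ 2) := by
  rw [← two_mul_sum_powersetCard_two, ← two_mul_sum_powersetCard_two]
  unfold lagrangian
  rw [sum_completeSplit]
  norm_num [Nat.factorial]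
  ring

theorem colorable_patternB4_iff {V : Type*} [Fintype V] [DecidableEq V] (G : KGraph 4 V) :
    G.Colorable patternB4 ↔ ∃ A : Finset V, G.edges ⊆ (completeSplit A).edges := by
  have key : ∀ (φ : V → Fin 2) (e : Finset V),
      e.val.map φ = ({0, 0, 1, 1} : Multiset (Fin 2)) ↔
        (e ∩ Finset.univ.filter fun v => φ v = 0).card = 2 ∧
          (e \ Finset.univ.filter fun v => φ v = 0).card = 2 := by
    intro φ e
    have h0 : e ∩ Finset.univ.filter (fun v => φ v = 0) = e.filter fun v => φ v = 0 := by
      ext v; simp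
    have h1 : e \ Finset.univ.filter (fun v => φ v = 0) = e.filter fun v => φ v = 1 := by
      ext v
      simp only [Finset.mem_sdiff, Finset.mem_filter, Finset.mem_univ, true_and]
      have : φ v = 0 ∨ φ v = 1 := by omega
      rcases this with h | h <;> simp [h]
    have hc : ∀ i, (e.val.map φ).count i = (e.filter fun v => φ v = i).card := fun i => by
      rw [Multiset.count_map]
      simp [Finset.card_def, eq_comm]
    -- A multiset of two colors is determined by its two multiplicities.
    rw [h0, h1, ← hc, ← hc, Multiset.ext, Fin.forall_fin_two]
    exact Iff.rfl
  constructor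
  · rintro ⟨φ, hφ⟩
    exact ⟨_, fun e he => mem_completeSplit.mpr ((key φ e).mp (hφ e he))⟩
  · rintro ⟨A, hA⟩
    refine ⟨(fun v => if v ∈ A then 0 else 1 : V → Fin 2), fun e he => ?_⟩
    refine (key (fun v => if v ∈ A then (0 : Fin 2) else 1) e).mpr ?_
    have : (Finset.univ.filter fun v => (if v ∈ A then (0 : Fin 2) else 1) = 0) = A := by
      ext v; simp
    rw [this]
    exact mem_completeSplit.mp (hA he)

end KGraph

/-! ### The extremal value as a function of the part sizes and of `n` -/

/-- The spectral radius of a complete split `4`-graph on `n` vertices whose part sizes have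
product `t`. -/
noncomputable def splitValue (α n t : ℝ) : ℝ :=
  6 * (t - n + 1) * t * (1 / (4 * t)) ^ (2 / α)

/-- In this form, for `n ≥ 1` and `α > 1`, both `t`-dependent factors are monotone in `t`, which
drives all later comparisons. -/
theorem splitValue_eq {α n t : ℝ} (ht : 0 < t) :
    splitValue α n t = 3 / 8 * (1 - (n - 1) / t) * (4 * t) ^ (2 - 2 / α) := by
  unfold splitValue
  rw [Real.rpow_sub (by positivity), one_div, Real.inv_rpow (by positivity), Real.rpow_two]
  field_simp
  ring

theorem two_sub_two_div_pos {α : ℝ} (hα : 1 < α) : 0 < 2 - 2 / α := by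
  have : 2 / α < 2 := by rw [div_lt_iff₀ (by linarith)]; linarith
  linarith

theorem splitValue_lt_splitValue {α n s t : ℝ} (hα : 1 < α) (hn : 1 ≤ n) (hs : 0 < s)
    (hns : n - 1 ≤ s) (hst : s < t) : splitValue α n s < splitValue α n t := by
  rw [splitValue_eq hs, splitValue_eq (hs.trans hst)]
  have h1 : (4 * s) ^ (2 - 2 / α) < (4 * t) ^ (2 - 2 / α) :=
    Real.rpow_lt_rpow (by positivity) (by linarith) (two_sub_two_div_pos hα)
  have h2 : (n - 1) / t ≤ (n - 1) / s := div_le_div_of_nonneg_left (by linarith) hs hst.le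
  have h3 : 0 < (4 * s) ^ (2 - 2 / α) := by positivity
  have h4 : 0 < 1 - (n - 1) / t := by
    rw [sub_pos, div_lt_one (hs.trans hst)]
    linarith
  calc _ ≤ 3 / 8 * (1 - (n - 1) / t) * (4 * s) ^ (2 - 2 / α) := by gcongr
    _ < _ := by gcongr

/-- The largest product of the sizes of the two parts of an `n`-set. -/
def balancedProd (n : ℕ) : ℕ := (n / 2) * ((n + 1) / 2)

theorem mul_le_balancedProd (a b : ℕ) : a * b ≤ balancedProd (a + b) := by
  unfold balancedProd
  obtain ⟨j, hj⟩ := Nat.even_or_odd' (a + b)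
  rcases hj with hj | hj
  · rw [hj, show 2 * j / 2 = j by omega, show (2 * j + 1) / 2 = j by omega]
    zify at *
    nlinarith [sq_nonneg ((a : ℤ) - b)]
  · rw [hj, show (2 * j + 1) / 2 = j by omega, show (2 * j + 1 + 1) / 2 = j + 1 by omega]
    -- No integer lies strictly between `j` and `j + 1`, so `(a - j) * (a - j - 1) ≥ 0`.
    have hb : (a : ℤ) ≤ j ∨ (j : ℤ) + 1 ≤ a := by omega
    have h : (b : ℤ) = 2 * j + 1 - a := by omega
    zify
    rw [h]
    rcases hb with hb | hb <;> nlinarith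

theorem eq_half_of_mul_eq_balancedProd {a b : ℕ} (h : a * b = balancedProd (a + b)) :
    a = (a + b) / 2 ∨ b = (a + b) / 2 := by
  unfold balancedProd at h
  obtain ⟨j, hj⟩ := Nat.even_or_odd' (a + b)
  rcases hj with hj | hj
  · rw [hj, show 2 * j / 2 = j by omega, show (2 * j + 1) / 2 = j by omega] at h
    rw [hj, show 2 * j / 2 = j by omega]
    have hb : (b : ℤ) = 2 * j - a := by omega
    zify at h
    rw [hb] at h
    have : ((a : ℤ) - j) * (a - j) = 0 := by linarith
    rcases mul_eq_zero.mp this with h | h <;> left <;> omega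
  · rw [hj, show (2 * j + 1) / 2 = j by omega, show (2 * j + 1 + 1) / 2 = j + 1 by omega] at h
    rw [hj, show (2 * j + 1) / 2 = j by omega]
    have hb : (b : ℤ) = 2 * j + 1 - a := by omega
    zify at h
    rw [hb] at h
    have : ((a : ℤ) - j) * (a - (j + 1)) = 0 := by linarith
    rcases mul_eq_zero.mp this with h | h
    · left; omega
    · right; omega

theorem balancedProd_pos {n : ℕ} (hn : 2 ≤ n) : 0 < balancedProd n :=
  Nat.mul_pos (by omega) (by omega)

theorem balancedProd_cases (n : ℕ) :
    ∃ j : ℕ, (n = 2 * j ∧ balancedProd n = j * j ∧ balancedProd (n + 1) = j * (j + 1)) ∨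
      (n = 2 * j + 1 ∧ balancedProd n = j * (j + 1) ∧
        balancedProd (n + 1) = (j + 1) * (j + 1)) := by
  obtain ⟨j, hj⟩ := Nat.even_or_odd' n
  refine ⟨j, ?_⟩
  unfold balancedProd
  rcases hj with hj | hj
  · left
    refine ⟨hj, ?_, ?_⟩ <;> congr 1 <;> omega
  · right
    refine ⟨hj, ?_, ?_⟩ <;> congr 1 <;> omega

theorem balancedProd_mul_le (m : ℕ) :
    (balancedProd m : ℝ) * (1 + 2 / (m + 1)) ≤ balancedProd (m + 1) := by
  obtain ⟨j, ⟨hm, h1, h2⟩ | ⟨hm, h1, h2⟩⟩ := balancedProd_cases m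
  · rw [h1, h2, hm]
    push_cast
    have hj : (0 : ℝ) ≤ j := Nat.cast_nonneg j
    rw [← sub_nonneg]
    have : (j : ℝ) * (j + 1) - j * j * (1 + 2 / (2 * j + 1)) = j / (2 * j + 1) := by
      field_simp
      ring
    rw [this]
    positivity
  · rw [h1, h2, hm]
    push_cast
    have hj : (0 : ℝ) ≤ j := Nat.cast_nonneg j
    rw [← sub_nonneg]
    have : ((j : ℝ) + 1) * (j + 1) - j * (j + 1) * (1 + 2 / (2 * j + 1 + 1)) = 1 := by
      field_simp
      ring
    rw [this]
    positivity

theorem mul_balancedProd_le {m : ℕ} (hm : 2 ≤ m) :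
    (m : ℝ) / balancedProd (m + 1) ≤ ((m : ℝ) - 1) / balancedProd m := by
  have p1 : (0 : ℝ) < balancedProd m := by exact_mod_cast balancedProd_pos hm
  have p2 : (0 : ℝ) < balancedProd (m + 1) := by
    exact_mod_cast balancedProd_pos (n := m + 1) (by omega)
  rw [div_le_div_iff₀ p2 p1]
  obtain ⟨j, ⟨hm', h1, h2⟩ | ⟨hm', h1, h2⟩⟩ := balancedProd_cases m
  · have hj : (1 : ℝ) ≤ j := by exact_mod_cast (by omega : 1 ≤ j)
    rw [h1, h2, hm']
    push_cast
    have : (2 * (j : ℝ) - 1) * (j * (j + 1)) - 2 * j * (j * j) = j * (j - 1) := by ring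
    nlinarith
  · have hj : (0 : ℝ) ≤ j := Nat.cast_nonneg j
    rw [h1, h2, hm']
    push_cast
    nlinarith [mul_nonneg hj hj]

theorem sq_sub_one_le_balancedProd (n : ℕ) : (n : ℝ) ^ 2 - 1 ≤ 4 * balancedProd n := by
  obtain ⟨j, ⟨hm, h1, -⟩ | ⟨hm, h1, -⟩⟩ := balancedProd_cases n <;>
  · rw [h1, hm]
    push_cast
    nlinarith

theorem sub_one_le_balancedProd {n : ℕ} : (n : ℝ) - 1 ≤ balancedProd n := by
  rcases Nat.eq_zero_or_pos n with rfl | hn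
  · simp [balancedProd]
  · have := mul_le_balancedProd 1 (n - 1)
    rw [one_mul, show 1 + (n - 1) = n by omega] at this
    have h : (n : ℝ) ≤ (balancedProd n : ℝ) + 1 := by exact_mod_cast (by omega)
    linarith

/-- The candidate for the extremal spectral radius on `n` vertices. -/
noncomputable def balancedValue (α : ℝ) (n : ℕ) : ℝ := splitValue α n (balancedProd n)

/-- The growth of `b_m` from one order to the next, against which the loss from deleting a vertex is
weighed. It comes from the power of `4 * t`; the other factor does not decrease. -/
theorem balancedValue_mul_le {α : ℝ} (hα : 1 < α) {m : ℕ} (hm : 2 ≤ m) :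
    balancedValue α m * (1 + 2 / ((m : ℝ) + 1)) ^ (2 - 2 / α) ≤ balancedValue α (m + 1) := by
  have hβ := two_sub_two_div_pos hα
  have p1 : (0 : ℝ) < balancedProd m := by exact_mod_cast balancedProd_pos hm
  have p2 : (0 : ℝ) < balancedProd (m + 1) := by
    exact_mod_cast balancedProd_pos (n := m + 1) (by omega)
  unfold balancedValue
  rw [splitValue_eq p1, splitValue_eq p2, mul_assoc, ← Real.mul_rpow (by positivity) (by positivity)]
  have h1 := mul_balancedProd_le hm
  have h2 := balancedProd_mul_le m
  have h3 : 0 ≤ 1 - ((m : ℝ) - 1) / balancedProd m := by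
    rw [sub_nonneg, div_le_one p1]
    exact sub_one_le_balancedProd
  have h4 : 1 - ((m : ℝ) - 1) / balancedProd m ≤
      1 - (((m + 1 : ℕ) : ℝ) - 1) / balancedProd (m + 1) := by
    push_cast
    rw [add_sub_cancel_right]
    linarith
  have h5 : 4 * (balancedProd m : ℝ) * (1 + 2 / (m + 1)) ≤ 4 * balancedProd (m + 1) := by
    linarith
  have h6 := Real.rpow_le_rpow (by positivity) h5 hβ.le
  exact mul_le_mul (by linarith) h6 (by positivity) (by linarith)

theorem le_balancedValue {α : ℝ} (hα : 1 < α) {n : ℕ} (hn : 6 ≤ n) :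
    3 / 8 * (1 - 6 / (n : ℝ)) * (n : ℝ) ^ (4 - 4 / α) ≤ balancedValue α n := by
  have hβ := two_sub_two_div_pos hα
  have p1 : (0 : ℝ) < balancedProd n := by exact_mod_cast balancedProd_pos (n := n) (by omega)
  have hn' : (6 : ℝ) ≤ n := by exact_mod_cast hn
  have hn0 : (0 : ℝ) < n := by linarith
  unfold balancedValue
  rw [splitValue_eq p1]
  have hT := sq_sub_one_le_balancedProd n
  have hu : (1 : ℝ) / n ^ 2 ≤ 1 := by
    rw [div_le_one (by positivity)]
    nlinarith
  have hu0 : (0 : ℝ) ≤ 1 / n ^ 2 := by positivity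
  -- The product of the part sizes is at least `(n ^ 2 - 1) / 4`. As the base `1 - 1 / n ^ 2` is
  -- below `1`, its exponent `2 - 2 / α` may be raised to `2`, making the error independent of `α`.
  have h1 : (n : ℝ) ^ (4 - 4 / α) * (1 - 1 / n ^ 2) ^ 2 ≤ (4 * balancedProd n) ^ (2 - 2 / α) := by
    calc (n : ℝ) ^ (4 - 4 / α) * (1 - 1 / n ^ 2) ^ 2
        ≤ (n : ℝ) ^ (4 - 4 / α) * (1 - 1 / (n : ℝ) ^ 2) ^ (2 - 2 / α) := by
          rw [← Real.rpow_two (1 - 1 / (n : ℝ) ^ 2)]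
          refine mul_le_mul_of_nonneg_left ?_ (by positivity)
          have hpos : 0 < 1 - 1 / (n : ℝ) ^ 2 := by
            rw [sub_pos, div_lt_one (by positivity)]
            nlinarith
          refine Real.rpow_le_rpow_of_exponent_ge hpos (by linarith) ?_
          have : 0 < 2 / α := by positivity
          linarith
      _ = ((n : ℝ) ^ 2 * (1 - 1 / (n : ℝ) ^ 2)) ^ (2 - 2 / α) := by
          rw [Real.mul_rpow (by positivity) (by linarith), ← Real.rpow_natCast (n : ℝ) 2,
            ← Real.rpow_mul hn0.le]
          congr 2
          push_cast
          ring
      _ ≤ _ := by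
          refine Real.rpow_le_rpow (mul_nonneg (by positivity) (by linarith)) ?_ hβ.le
          have : (n : ℝ) ^ 2 * (1 - 1 / (n : ℝ) ^ 2) = n ^ 2 - 1 := by field_simp
          linarith
  have h2 : ((n : ℝ) - 1) / balancedProd n ≤ 4 / n := by
    rw [div_le_div_iff₀ p1 hn0]
    nlinarith
  have h3 : 1 - 6 / (n : ℝ) ≤ (1 - 4 / (n : ℝ)) * (1 - 1 / n ^ 2) ^ 2 := by
    have hv : 1 / (n : ℝ) ≤ 1 / 6 := one_div_le_one_div_of_le (by norm_num) hn'
    have hv0 : 0 < 1 / (n : ℝ) := by positivity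
    rw [show (6 : ℝ) / n = 6 * (1 / n) by ring, show (4 : ℝ) / n = 4 * (1 / n) by ring,
      show (1 : ℝ) / n ^ 2 = (1 / n) ^ 2 by ring]
    set v := 1 / (n : ℝ)
    have h5 : 1 - 2 * v ^ 2 ≤ (1 - v ^ 2) ^ 2 := by nlinarith [sq_nonneg (v ^ 2)]
    have h6 : (1 - 4 * v) * (1 - 2 * v ^ 2) ≤ (1 - 4 * v) * (1 - v ^ 2) ^ 2 :=
      mul_le_mul_of_nonneg_left h5 (by linarith)
    nlinarith [mul_pos hv0 hv0, mul_pos (mul_pos hv0 hv0) hv0]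
  have hpow : 0 < (n : ℝ) ^ (4 - 4 / α) := by positivity
  have h4n : 0 ≤ 1 - 4 / (n : ℝ) := by
    rw [sub_nonneg, div_le_one hn0]
    linarith
  calc 3 / 8 * (1 - 6 / (n : ℝ)) * (n : ℝ) ^ (4 - 4 / α)
      ≤ 3 / 8 * ((1 - 4 / (n : ℝ)) * (1 - 1 / n ^ 2) ^ 2) * (n : ℝ) ^ (4 - 4 / α) := by gcongr
    _ = 3 / 8 * (1 - 4 / (n : ℝ)) * ((n : ℝ) ^ (4 - 4 / α) * (1 - 1 / n ^ 2) ^ 2) := by ring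
    _ ≤ _ := by
        refine mul_le_mul (by linarith) h1 (by positivity) ?_
        linarith

theorem balancedValue_pos {α : ℝ} {n : ℕ} (hn : 4 ≤ n) : 0 < balancedValue α n := by
  have p1 : (0 : ℝ) < balancedProd n := by exact_mod_cast balancedProd_pos (n := n) (by omega)
  have h := mul_le_balancedProd 2 (n - 2)
  rw [show 2 + (n - 2) = n by omega] at h
  have h' : (n : ℝ) ≤ balancedProd n := by exact_mod_cast (by omega)
  unfold balancedValue splitValue
  have : (0 : ℝ) < balancedProd n - n + 1 := by linarith
  positivity

/-- The gain obtained by deleting a vertex of weight noticeably below average. -/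
theorem eventually_gain {α δ : ℝ} (hα : 1 < α) (hδ : 0 < δ) :
    ∃ c > 0, ∃ N : ℕ, ∀ m ≥ N, ∀ y : ℝ, 0 ≤ y → y ≤ (1 - δ) / ((m : ℝ) + 1) →
      (1 + c / ((m : ℝ) + 1)) * (1 - y) ^ (4 / α) ≤
        (1 - 4 * y) * (1 + 2 / ((m : ℝ) + 1)) ^ (2 - 2 / α) := by
  set β := 4 - 4 / α with hβdef
  have hβ : 0 < β := by
    have := two_sub_two_div_pos hα
    have h : β = 2 * (2 - 2 / α) := by rw [hβdef]; ring
    linarith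
  have hβ2 : 2 - 2 / α = β / 2 := by rw [hβdef]; ring
  -- To first order, the logarithms of the two sides without the factor `1 + c / n` differ by `β / n
  -- - β * y ≥ β * δ / n`. Half of this gain becomes `c`; the other half absorbs the second-order
  -- errors `(β + 32) / n ^ 2`, which fixes the threshold. The `8` ensures `1 - 4 * y ≥ 1 / 2`.
  refine ⟨β * δ / 2, by positivity, ⌈2 * (β + 32) / (β * δ)⌉₊ + 8, fun m hm y hy0 hy => ?_⟩
  set n : ℝ := (m : ℝ) + 1 with hn
  have hmN : 2 * (β + 32) / (β * δ) ≤ n ∧ 8 ≤ n := by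
    have h1 := Nat.le_ceil (2 * (β + 32) / (β * δ))
    have h2 : ((⌈2 * (β + 32) / (β * δ)⌉₊ : ℝ) + 8) ≤ m := by exact_mod_cast hm
    have h3 : (0 : ℝ) ≤ (⌈2 * (β + 32) / (β * δ)⌉₊ : ℝ) := Nat.cast_nonneg _
    constructor <;> linarith
  obtain ⟨hN1, hN2⟩ := hmN
  have hn0 : 0 < n := by linarith
  have hyn : y ≤ 1 / n := hy.trans (by gcongr; linarith)
  have hy8 : y ≤ 1 / 8 := hyn.trans (one_div_le_one_div_of_le (by norm_num) hN2)
  have e1 : 1 + β * δ / 2 / n ≤ Real.exp (β * δ / 2 / n) := by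
    linarith [Real.add_one_le_exp (β * δ / 2 / n)]
  have e2 : (1 - y) ^ (4 / α) ≤ Real.exp (-(4 / α * y)) := by
    have h := Real.add_one_le_exp (-y)
    calc (1 - y) ^ (4 / α) ≤ (Real.exp (-y)) ^ (4 / α) :=
          Real.rpow_le_rpow (by linarith) (by linarith) (by positivity)
      _ = _ := by
          rw [← Real.exp_mul]
          congr 1
          ring
  have e3 : Real.exp (-(4 * y / (1 - 4 * y))) ≤ 1 - 4 * y := by
    have hp : 0 < 1 - 4 * y := by linarith
    rw [← Real.le_log_iff_exp_le hp]
    have h := Real.one_sub_inv_le_log_of_pos hp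
    have : 1 - (1 - 4 * y)⁻¹ = -(4 * y / (1 - 4 * y)) := by
      field_simp
      ring
    linarith
  have e4 : Real.exp (β / (n + 1)) ≤ (1 + 2 / n) ^ (2 - 2 / α) := by
    have hp : 0 < 1 + 2 / n := by positivity
    rw [Real.rpow_def_of_pos hp, Real.exp_le_exp, hβ2]
    have h := Real.le_log_one_add_of_nonneg (x := 2 / n) (by positivity)
    have h' : 2 * (2 / n) / (2 / n + 2) = 2 / (n + 1) := by
      field_simp
      ring
    rw [h'] at h
    calc β / (n + 1) = 2 / (n + 1) * (β / 2) := by field_simp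
      _ ≤ _ := by gcongr
  -- The comparison of exponents: the error `32 / n ^ 2` comes from `4 * y / (1 - 4 * y) - 4 * y`,
  -- and `β / n ^ 2` from replacing `n + 1` by `n`.
  have e5 : β * δ / 2 / n + -(4 / α * y) ≤ -(4 * y / (1 - 4 * y)) + β / (n + 1) := by
    have hp : 0 < 1 - 4 * y := by linarith
    have a1 : 4 * y / (1 - 4 * y) - 4 / α * y = β * y + 16 * y ^ 2 / (1 - 4 * y) := by
      rw [hβdef]
      field_simp
      ring
    have a2 : 16 * y ^ 2 / (1 - 4 * y) ≤ 32 / n ^ 2 := by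
      calc 16 * y ^ 2 / (1 - 4 * y) ≤ 16 * (1 / n) ^ 2 / (1 / 2) := by
            gcongr
            linarith
        _ = 32 / n ^ 2 := by
            field_simp
            ring
    have a3 : β / n - β / n ^ 2 ≤ β / (n + 1) := by
      have : β / (n + 1) - (β / n - β / n ^ 2) = β / (n ^ 2 * (n + 1)) := by
        field_simp
        ring
      have h : 0 ≤ β / (n ^ 2 * (n + 1)) := by positivity
      linarith
    have a4 : β * y ≤ β / n - β * δ / n := by
      calc β * y ≤ β * ((1 - δ) / n) := by gcongr
        _ = _ := by ring
    have a5 : (β + 32) / n ^ 2 ≤ β * δ / 2 / n := by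
      rw [div_le_iff₀ (by positivity)] at hN1 ⊢
      have : β * δ / 2 / n * n ^ 2 = n * (β * δ) / 2 := by field_simp
      linarith
    have a6 : (β + 32) / n ^ 2 = β / n ^ 2 + 32 / n ^ 2 := by ring
    have a7 : β * δ / n = 2 * (β * δ / 2 / n) := by ring
    linarith
  calc (1 + β * δ / 2 / n) * (1 - y) ^ (4 / α)
      ≤ Real.exp (β * δ / 2 / n) * Real.exp (-(4 / α * y)) :=
        mul_le_mul e1 e2 (Real.rpow_nonneg (by linarith) _) (by positivity)
    _ ≤ Real.exp (-(4 * y / (1 - 4 * y))) * Real.exp (β / (n + 1)) := by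
        rw [← Real.exp_add, ← Real.exp_add]
        exact Real.exp_le_exp.mpr e5
    _ ≤ _ := mul_le_mul e3 e4 (by positivity) (by linarith)

/-- The second elementary symmetric polynomial is at most its value at the mean. -/
theorem sq_sum_sub_sum_sq_le {V : Type*} (A : Finset V) (hA : 0 < A.card) (x : V → ℝ) :
    (∑ v ∈ A, x v) ^ 2 - ∑ v ∈ A, x v ^ 2 ≤ (1 - 1 / (A.card : ℝ)) * (∑ v ∈ A, x v) ^ 2 := by
  have hA' : (0 : ℝ) < A.card := by exact_mod_cast hA
  have h := sq_sum_le_card_mul_sum_sq (s := A) (f := x)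
  have : (∑ v ∈ A, x v) ^ 2 / A.card ≤ ∑ v ∈ A, x v ^ 2 := by
    rw [div_le_iff₀ hA']
    linarith
  have h2 : (1 - 1 / (A.card : ℝ)) * (∑ v ∈ A, x v) ^ 2 =
      (∑ v ∈ A, x v) ^ 2 - (∑ v ∈ A, x v) ^ 2 / A.card := by ring
  linarith

theorem sq_sum_sub_sum_sq_nonneg {V : Type*} (A : Finset V) {x : V → ℝ} (hx : ∀ v, 0 ≤ x v) :
    0 ≤ (∑ v ∈ A, x v) ^ 2 - ∑ v ∈ A, x v ^ 2 := by
  classical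
  rw [← two_mul_sum_powersetCard_two]
  exact mul_nonneg zero_le_two
    (Finset.sum_nonneg fun s _ => Finset.prod_nonneg fun v _ => hx v)

/-! ### Spectral radius of complete split graphs -/

namespace KGraph

section Split

variable {V : Type*} [Fintype V] [DecidableEq V] {α : ℝ}

theorem cast_card_add_card_compl (A : Finset V) :
    (A.card : ℝ) + (Aᶜ.card : ℝ) = Fintype.card V := by
  exact_mod_cast Finset.card_add_card_compl A

theorem lagrangian_completeSplit_le (hα : 1 < α) (A : Finset V) (hA : 0 < A.card)
    (hB : 0 < Aᶜ.card) {x : V → ℝ} (hx : ∀ v, 0 ≤ x v) (hx1 : ∑ v, x v ^ α = 1) :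
    (completeSplit A).lagrangian x ≤
      splitValue α (Fintype.card V) ((A.card : ℝ) * (Aᶜ.card : ℝ)) := by
  have hα0 : 0 < α := by linarith
  have ha : (1 : ℝ) ≤ A.card := by exact_mod_cast hA
  have hb : (1 : ℝ) ≤ Aᶜ.card := by exact_mod_cast hB
  have hcard := cast_card_add_card_compl A
  have hX := Finset.sum_nonneg (s := A) fun v _ => hx v
  have hY := Finset.sum_nonneg (s := Aᶜ) fun v _ => hx v
  have hpX := Real.rpow_sum_le_const_mul_sum_rpow_of_nonneg A hα.le fun v _ => hx v
  have hpY := Real.rpow_sum_le_const_mul_sum_rpow_of_nonneg Aᶜ hα.le fun v _ => hx v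
  have hpq : ∑ v ∈ A, x v ^ α + ∑ v ∈ Aᶜ, x v ^ α = 1 := by
    rw [Finset.sum_add_sum_compl, hx1]
  have hp : 0 ≤ ∑ v ∈ A, x v ^ α := Finset.sum_nonneg fun v _ => Real.rpow_nonneg (hx v) _
  have hq : 0 ≤ ∑ v ∈ Aᶜ, x v ^ α := Finset.sum_nonneg fun v _ => Real.rpow_nonneg (hx v) _
  have hfX := sq_sum_sub_sum_sq_le A hA x
  have hfY := sq_sum_sub_sum_sq_le Aᶜ hB x
  have hnX := sq_sum_sub_sum_sq_nonneg A hx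
  have hnY := sq_sum_sub_sum_sq_nonneg Aᶜ hx
  rw [lagrangian_completeSplit]
  set X := ∑ v ∈ A, x v
  set Y := ∑ v ∈ Aᶜ, x v
  set p := ∑ v ∈ A, x v ^ α
  set q := ∑ v ∈ Aᶜ, x v ^ α
  set a := (A.card : ℝ)
  set b := (Aᶜ.card : ℝ)
  set t := a * b with ht
  have ht0 : 0 < t := by positivity
  -- Power means bound each part's sum by its `α`-mass; the two masses add up to `1`, so their
  -- product is at most `1 / 4`.
  have hXY : (X * Y) ^ α ≤ t ^ α * (1 / (4 * t)) := by
    have h4 : p * q ≤ 1 / 4 := by nlinarith [sq_nonneg (p - q)]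
    calc (X * Y) ^ α = X ^ α * Y ^ α := Real.mul_rpow hX hY
      _ ≤ (a ^ (α - 1) * p) * (b ^ (α - 1) * q) :=
          mul_le_mul hpX hpY (Real.rpow_nonneg hY _) (by positivity)
      _ = t ^ (α - 1) * (p * q) := by
          rw [ht, Real.mul_rpow (by positivity) (by positivity)]
          ring
      _ ≤ t ^ (α - 1) * (1 / 4) := by gcongr
      _ = t ^ α * (1 / (4 * t)) := by
          rw [Real.rpow_sub_one ht0.ne']
          field_simp
  have hXY2 : (X * Y) ^ 2 ≤ t ^ 2 * (1 / (4 * t)) ^ (2 / α) := by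
    have h := Real.rpow_le_rpow (Real.rpow_nonneg (mul_nonneg hX hY) _) hXY
      (z := 2 / α) (by positivity)
    rw [← Real.rpow_mul (mul_nonneg hX hY),
      Real.mul_rpow (x := t ^ α) (by positivity) (by positivity),
      ← Real.rpow_mul ht0.le, mul_div_cancel₀ _ hα0.ne', Real.rpow_two, Real.rpow_two] at h
    exact h
  have ha1 : 0 ≤ 1 - 1 / a := by
    rw [sub_nonneg, div_le_one (by linarith)]
    exact ha
  have hb1 : 0 ≤ 1 - 1 / b := by
    rw [sub_nonneg, div_le_one (by linarith)]
    exact hb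
  calc _ ≤ 6 * ((1 - 1 / a) * X ^ 2) * ((1 - 1 / b) * Y ^ 2) := by gcongr
    _ = 6 * ((1 - 1 / a) * (1 - 1 / b)) * (X * Y) ^ 2 := by ring
    _ ≤ 6 * ((1 - 1 / a) * (1 - 1 / b)) * (t ^ 2 * (1 / (4 * t)) ^ (2 / α)) := by gcongr
    _ = splitValue α (Fintype.card V) t := by
        unfold splitValue
        rw [← hcard, ht]
        field_simp
        ring

theorem spectralRadius_completeSplit (hα : 1 < α) (A : Finset V) (hA : 0 < A.card)
    (hB : 0 < Aᶜ.card) : (completeSplit A).spectralRadius α =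
      splitValue α (Fintype.card V) ((A.card : ℝ) * (Aᶜ.card : ℝ)) := by
  have hα0 : 0 < α := by linarith
  have : Nonempty V := ⟨(Finset.card_pos.mp hA).choose⟩
  refine le_antisymm (spectralRadius_le hα0 _ fun x hx hx1 =>
    lagrangian_completeSplit_le hα A hA hB hx hx1) ?_
  have ha : (0 : ℝ) < A.card := by exact_mod_cast hA
  have hb : (0 : ℝ) < Aᶜ.card := by exact_mod_cast hB
  have hcard := cast_card_add_card_compl A
  -- The optimal vector is constant on each part and gives each part `α`-mass `1 / 2`.
  set p : ℝ := (1 / (2 * A.card)) ^ (1 / α) with hp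
  set q : ℝ := (1 / (2 * Aᶜ.card)) ^ (1 / α) with hq
  have hpα : p ^ α = 1 / (2 * A.card) := by
    rw [hp, ← Real.rpow_mul (by positivity), one_div_mul_cancel hα0.ne', Real.rpow_one]
  have hqα : q ^ α = 1 / (2 * Aᶜ.card) := by
    rw [hq, ← Real.rpow_mul (by positivity), one_div_mul_cancel hα0.ne', Real.rpow_one]
  set x : V → ℝ := fun v => if v ∈ A then p else q with hxdef
  have sA : ∀ f : ℝ → ℝ, ∑ v ∈ A, f (x v) = A.card * f p := fun f => by
    rw [Finset.sum_congr rfl fun v hv => show f (x v) = f p by simp only [hxdef, if_pos hv]]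
    simp
  have sB : ∀ f : ℝ → ℝ, ∑ v ∈ Aᶜ, f (x v) = Aᶜ.card * f q := fun f => by
    rw [Finset.sum_congr rfl fun v hv => show f (x v) = f q by
      simp only [hxdef, if_neg (Finset.mem_compl.mp hv)]]
    simp
  have hx1 : ∑ v, x v ^ α = 1 := by
    rw [← Finset.sum_add_sum_compl A, sA (· ^ α), sB (· ^ α), hpα, hqα]
    field_simp
    norm_num
  have hle := lagrangian_le_spectralRadius hα0 (completeSplit A) (x := x)
    (fun v => by rw [hxdef]; dsimp only; split_ifs <;> positivity) hx1
  rw [lagrangian_completeSplit, sA (fun r => r), sB (fun r => r), sA (· ^ 2), sB (· ^ 2)] at hle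
  refine le_trans (le_of_eq ?_) hle
  have hpq : (1 / (4 * ((A.card : ℝ) * (Aᶜ.card : ℝ)))) ^ (2 / α) = (p * q) ^ 2 := by
    rw [hp, hq, ← Real.mul_rpow (by positivity) (by positivity), ← Real.rpow_natCast,
      ← Real.rpow_mul (by positivity)]
    congr 1
    · field_simp
      norm_num
    · push_cast
      ring
  unfold splitValue
  rw [hpq, ← hcard]
  ring

/-- Among complete split `4`-graphs the balanced ones maximize the Lagrangian. -/
theorem lagrangian_completeSplit_le_balancedValue (hα : 1 < α) (hV : 4 ≤ Fintype.card V)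
    (A : Finset V) {x : V → ℝ} (hx : ∀ v, 0 ≤ x v) (hx1 : ∑ v, x v ^ α = 1) :
    (completeSplit A).lagrangian x ≤ balancedValue α (Fintype.card V) ∧
      ((completeSplit A).lagrangian x = balancedValue α (Fintype.card V) →
        A.card * Aᶜ.card = balancedProd (Fintype.card V)) := by
  have hpos := balancedValue_pos (α := α) hV
  rcases Nat.eq_zero_or_pos A.card with hA | hA
  · have h0 : (completeSplit A).lagrangian x = 0 := by
      rw [lagrangian_completeSplit, Finset.card_eq_zero.mp hA]
      simp
    rw [h0]
    exact ⟨hpos.le, fun h => absurd h hpos.ne⟩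
  rcases Nat.eq_zero_or_pos Aᶜ.card with hB | hB
  · have h0 : (completeSplit A).lagrangian x = 0 := by
      rw [lagrangian_completeSplit, Finset.card_eq_zero.mp hB]
      simp
    rw [h0]
    exact ⟨hpos.le, fun h => absurd h hpos.ne⟩
  have hle := lagrangian_completeSplit_le hα A hA hB hx hx1
  have hmul := mul_le_balancedProd A.card Aᶜ.card
  rw [Finset.card_add_card_compl] at hmul
  rcases hmul.eq_or_lt with heq | hlt
  · refine ⟨?_, fun _ => heq⟩
    unfold balancedValue
    rw [← heq]
    push_cast
    exact hle
  · have hcard := cast_card_add_card_compl A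
    have ha : (1 : ℝ) ≤ A.card := by exact_mod_cast hA
    have hb : (1 : ℝ) ≤ Aᶜ.card := by exact_mod_cast hB
    have hstrict : splitValue α (Fintype.card V) ((A.card : ℝ) * (Aᶜ.card : ℝ)) <
        balancedValue α (Fintype.card V) := by
      refine splitValue_lt_splitValue hα ?_ (by positivity) ?_ (by exact_mod_cast hlt)
      · linarith
      · rw [← hcard]
        nlinarith
    exact ⟨(hle.trans_lt hstrict).le, fun h => absurd h (hle.trans_lt hstrict).ne⟩

theorem completeSplit_compl (A : Finset V) : completeSplit Aᶜ = completeSplit A := by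
  ext e
  rw [mem_completeSplit, mem_completeSplit, and_comm]
  have h1 : e \ Aᶜ = e ∩ A := by ext v; simp
  have h2 : e ∩ Aᶜ = e \ A := by ext v; simp
  rw [h1, h2]

theorem completeSplit_iso {A B : Finset V} (h : A.card = B.card) :
    (completeSplit A).Iso (completeSplit B) := by
  have e : {v // v ∈ A} ≃ {v // v ∈ B} := Finset.equivOfCardEq h
  set f : Equiv.Perm V := e.extendSubtype with hf
  have hmem : ∀ v, f v ∈ B ↔ v ∈ A := fun v =>
    ⟨fun hv => by
      by_contra hA
      exact e.extendSubtype_not_mem v hA hv, fun hv => e.extendSubtype_mem v hv⟩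
  refine ⟨f, fun s => ?_⟩
  rw [mem_completeSplit, mem_completeSplit]
  have h1 : s.map f.toEmbedding ∩ B = (s ∩ A).map f.toEmbedding := by
    ext v
    obtain ⟨u, rfl⟩ := f.surjective v
    simp [hmem]
  have h2 : s.map f.toEmbedding \ B = (s \ A).map f.toEmbedding := by
    ext v
    obtain ⟨u, rfl⟩ := f.surjective v
    simp [hmem]
  rw [h1, h2, Finset.card_map, Finset.card_map]

/-- The Lagrangian at the all-ones vector counts edges. -/
theorem four_mul_card_completeSplit (A : Finset V) :
    4 * ((completeSplit A).edges.card : ℝ) =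
      ((A.card : ℝ) ^ 2 - A.card) * ((Aᶜ.card : ℝ) ^ 2 - Aᶜ.card) := by
  have h := lagrangian_completeSplit A (fun _ => (1 : ℝ))
  unfold lagrangian at h
  simp only [Finset.prod_const_one, Finset.sum_const, nsmul_eq_mul, mul_one, one_pow] at h
  norm_num [Nat.factorial] at h
  linarith

end Split

end KGraph

/-! ### The extremal graph and colorable graphs -/

/-- The smaller part of `B4 n`. -/
def B4Part (n : ℕ) : Finset (Fin n) := Finset.univ.filter fun v => v.val < n / 2

theorem card_B4Part (n : ℕ) : (B4Part n).card = n / 2 := by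
  unfold B4Part
  rw [Fin.card_filter_val_lt]
  omega

theorem card_compl_B4Part (n : ℕ) : (B4Part n)ᶜ.card = (n + 1) / 2 := by
  rw [Finset.card_compl, card_B4Part, Fintype.card_fin]
  omega

theorem B4_eq_completeSplit (n : ℕ) : B4 n = KGraph.completeSplit (B4Part n) := by
  ext e
  rw [KGraph.mem_completeSplit]
  have h1 : e ∩ B4Part n = e.filter fun v => v.val < n / 2 := by
    ext v; simp [B4Part]
  have h2 : e \ B4Part n = e.filter fun v => ¬ v.val < n / 2 := by
    ext v; simp [B4Part]
  rw [h1, h2]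
  simp [B4]

theorem spectralRadius_B4 {α : ℝ} (hα : 1 < α) {n : ℕ} (hn : 2 ≤ n) :
    (B4 n).spectralRadius α = balancedValue α n := by
  rw [B4_eq_completeSplit, KGraph.spectralRadius_completeSplit hα, card_B4Part, card_compl_B4Part,
    Fintype.card_fin, balancedValue, balancedProd, Nat.cast_mul]
  · rw [card_B4Part]; omega
  · rw [card_compl_B4Part]; omega

theorem KGraph.completeSplit_iso_B4 {n : ℕ} {A : Finset (Fin n)}
    (h : A.card * Aᶜ.card = balancedProd n) : (completeSplit A).Iso (B4 n) := by
  have hc : A.card + Aᶜ.card = n := by rw [Finset.card_add_card_compl, Fintype.card_fin]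
  rw [B4_eq_completeSplit]
  rcases eq_half_of_mul_eq_balancedProd (by rw [hc]; exact h) with h1 | h1
  · exact completeSplit_iso (by rw [card_B4Part, h1, hc])
  · rw [← completeSplit_compl A]
    exact completeSplit_iso (by rw [card_B4Part, h1, hc])

/-- `P`-colorable `4`-graphs have at most the spectral radius of `B₄(n)`. -/
theorem KGraph.Colorable.spectralRadius_le {α : ℝ} (hα : 1 < α) {n : ℕ} (hn : 4 ≤ n)
    {G : KGraph 4 (Fin n)} (hG : G.Colorable patternB4) :
    G.spectralRadius α ≤ balancedValue α n := by
  have : Nonempty (Fin n) := ⟨⟨0, by omega⟩⟩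
  obtain ⟨A, hA⟩ := (KGraph.colorable_patternB4_iff G).mp hG
  refine KGraph.spectralRadius_le (by linarith) G fun x hx hx1 => ?_
  have h := (KGraph.lagrangian_completeSplit_le_balancedValue hα
    (by rwa [Fintype.card_fin]) A hx hx1).1
  rw [Fintype.card_fin] at h
  refine le_trans ?_ h
  exact mul_le_mul_of_nonneg_left (Finset.sum_le_sum_of_subset_of_nonneg hA fun e _ _ =>
    Finset.prod_nonneg fun v _ => hx v) (Nat.cast_nonneg _)

/-- A `P`-colorable `4`-graph with a positive maximizer and the extremal spectral radius
is `B₄(n)`. -/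
theorem KGraph.Colorable.iso_B4 {α : ℝ} (hα : 1 < α) {n : ℕ} (hn : 4 ≤ n)
    {G : KGraph 4 (Fin n)} (hG : G.Colorable patternB4) {x : Fin n → ℝ} (hx : ∀ v, 0 < x v)
    (hx1 : ∑ v, x v ^ α = 1) (hval : G.lagrangian x = balancedValue α n) : G.Iso (B4 n) := by
  obtain ⟨A, hA⟩ := (KGraph.colorable_patternB4_iff G).mp hG
  obtain ⟨h1, h2⟩ := KGraph.lagrangian_completeSplit_le_balancedValue hα
    (by rwa [Fintype.card_fin]) A (fun v => (hx v).le) hx1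
  rw [Fintype.card_fin] at h1 h2
  have hedges : G.edges = (completeSplit A).edges := by
    by_contra hne
    obtain ⟨e, he, he'⟩ := Finset.exists_of_ssubset (hA.ssubset_of_ne hne)
    -- Strict positivity of all weights makes a missing edge cost something.
    have hlt : G.lagrangian x < (completeSplit A).lagrangian x := by
      refine mul_lt_mul_of_pos_left ?_ (by exact_mod_cast Nat.factorial_pos 4)
      exact Finset.sum_lt_sum_of_subset hA he he' (Finset.prod_pos fun v _ => hx v)
        fun f _ _ => (Finset.prod_pos fun v _ => hx v).le
    linarith
  have hGA : G = completeSplit A := KGraph.ext hedges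
  rw [hGA] at hval ⊢
  exact completeSplit_iso_B4 (h2 hval)

/-! ### The Turán density -/

theorem cast_choose_four {n : ℕ} (hn : 4 ≤ n) :
    (n.choose 4 : ℝ) = n * (n - 1) * (n - 2) * (n - 3) / 24 := by
  obtain ⟨m, rfl⟩ := Nat.exists_eq_add_of_le' hn
  have h := Nat.descFactorial_eq_factorial_mul_choose (m + 4) 4
  have h' : ((m + 4).descFactorial 4 : ℝ) = 24 * (m + 4).choose 4 := by
    rw [h]
    norm_num [Nat.factorial]
  rw [eq_div_iff (by norm_num), mul_comm, ← h']
  simp only [Nat.descFactorial_succ, Nat.descFactorial_zero, mul_one, Nat.sub_zero,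
    show m + 4 - 1 = m + 3 by omega, show m + 4 - 2 = m + 2 by omega,
    show m + 4 - 3 = m + 1 by omega]
  push_cast
  ring

/-- A Turán pair with the pattern `{1,1,2,2}` has Turán density `3/8`. -/
theorem IsTuranPair.turanDensity_eq {𝓕 : KFamily 4} (h : IsTuranPair 𝓕 patternB4) :
    turanDensity 𝓕 = 3 / 8 := by
  obtain ⟨hfree, n₀, hn₀⟩ := h
  have hbdd : ∀ n, BddAbove {m : ℕ | ∃ H : KGraph 4 (Fin n), H.Free 𝓕 ∧ H.edges.card = m} := by
    refine fun n => ⟨Fintype.card (Finset (Fin n)), ?_⟩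
    rintro m ⟨H, -, rfl⟩
    exact Finset.card_le_univ _
  have hB4 : ∀ n, (B4 n).Free 𝓕 := fun n => by
    refine hfree n _ ((KGraph.colorable_patternB4_iff _).mpr ⟨B4Part n, ?_⟩)
    rw [B4_eq_completeSplit]
  -- The factor `1 + 3 / (n - 3) = n / (n - 3)` cancels `n - 3` in the binomial coefficient, leaving
  -- a clean upper bound for the edges of any complete split graph.
  have hlim : Tendsto (fun n : ℕ => 3 / 8 * (1 + 3 / ((n : ℝ) - 3))) atTop (𝓝 (3 / 8)) := by
    have h1 : Tendsto (fun n : ℕ => (n : ℝ) - 3) atTop atTop :=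
      tendsto_atTop_add_const_right _ _ tendsto_natCast_atTop_atTop
    have h2 := ((h1.const_div_atTop 3).const_add 1).const_mul (3 / 8)
    simpa using h2
  refine Tendsto.limUnder_eq (tendsto_of_tendsto_of_tendsto_of_le_of_le' tendsto_const_nhds hlim
    ?_ ?_)
  · filter_upwards [eventually_ge_atTop 4] with n hn
    have hn' : (4 : ℝ) ≤ n := by exact_mod_cast hn
    have h1 : ((B4 n).edges.card : ℝ) ≤ turanNumber n 𝓕 := by
      exact_mod_cast le_csSup (hbdd n) ⟨B4 n, hB4 n, rfl⟩
    have hp : 0 < (n : ℝ) * (n - 1) * (n - 2) * (n - 3) / 24 := by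
      have : 0 < (n : ℝ) - 1 := by linarith
      have : 0 < (n : ℝ) - 2 := by linarith
      have : 0 < (n : ℝ) - 3 := by linarith
      positivity
    rw [cast_choose_four hn, le_div_iff₀ hp]
    refine le_trans ?_ h1
    have h2 := KGraph.four_mul_card_completeSplit (B4Part n)
    have hc := KGraph.cast_card_add_card_compl (B4Part n)
    rw [Fintype.card_fin] at hc
    rw [← B4_eq_completeSplit] at h2
    have ht : ((B4Part n).card : ℝ) * ((B4Part n)ᶜ.card : ℝ) = balancedProd n := by
      rw [card_B4Part, card_compl_B4Part, balancedProd, Nat.cast_mul]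
    have hT := sq_sub_one_le_balancedProd n
    set t := (balancedProd n : ℝ)
    have h3 : 4 * ((B4 n).edges.card : ℝ) = t * (t - n + 1) := by
      rw [h2, ← ht, ← hc]
      ring
    have h4 : ((n : ℝ) ^ 2 - 1) / 4 * (((n : ℝ) ^ 2 - 1) / 4 - n + 1) ≤ t * (t - n + 1) := by
      have : 0 ≤ ((n : ℝ) ^ 2 - 1) / 4 - n + 1 := by nlinarith
      exact mul_le_mul (by linarith) (by linarith) this (by nlinarith)
    have h5 : ((n : ℝ) ^ 2 - 1) / 4 * (((n : ℝ) ^ 2 - 1) / 4 - n + 1) -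
        4 * (3 / 8 * (n * (n - 1) * (n - 2) * (n - 3) / 24)) =
        (n - 1) * (n - 3) * (2 * n - 1) / 16 := by ring
    have h6 : 0 ≤ ((n : ℝ) - 1) * (n - 3) * (2 * n - 1) / 16 := by
      have : 0 ≤ (n : ℝ) - 1 := by linarith
      have : 0 ≤ (n : ℝ) - 3 := by linarith
      have : 0 ≤ 2 * (n : ℝ) - 1 := by linarith
      positivity
    linarith
  · filter_upwards [eventually_ge_atTop 4, eventually_ge_atTop n₀] with n hn hnn
    have hn' : (4 : ℝ) ≤ n := by exact_mod_cast hn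
    obtain ⟨H, hH, hHc⟩ : ∃ H : KGraph 4 (Fin n), H.Free 𝓕 ∧ H.edges.card = turanNumber n 𝓕 :=
      Nat.sSup_mem (s := {m : ℕ | ∃ H : KGraph 4 (Fin n), H.Free 𝓕 ∧ H.edges.card = m})
        ⟨_, B4 n, hB4 n, rfl⟩ (hbdd n)
    obtain ⟨A, hA⟩ := (KGraph.colorable_patternB4_iff H).mp (hn₀ n hnn H hH hHc)
    have h1 : (turanNumber n 𝓕 : ℝ) ≤ (KGraph.completeSplit A).edges.card := by
      rw [← hHc]
      exact_mod_cast Finset.card_le_card hA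
    have h2 := KGraph.four_mul_card_completeSplit A
    have hc := KGraph.cast_card_add_card_compl A
    rw [Fintype.card_fin] at hc
    have n1 : 0 < (n : ℝ) - 1 := by linarith
    have n2 : 0 < (n : ℝ) - 2 := by linarith
    have n3 : 0 < (n : ℝ) - 3 := by linarith
    have hp : 0 < (n : ℝ) * (n - 1) * (n - 2) * (n - 3) / 24 := by positivity
    rw [cast_choose_four hn, div_le_iff₀ hp]
    refine h1.trans ?_
    have h3 : ((A.card : ℝ) ^ 2 - A.card) * ((Aᶜ.card : ℝ) ^ 2 - Aᶜ.card) ≤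
        (n : ℝ) ^ 2 / 4 * ((n - 2) ^ 2 / 4) := by
      rcases Nat.eq_zero_or_pos A.card with hA0 | hA0
      · rw [hA0]
        have : 0 ≤ (n : ℝ) ^ 2 / 4 * ((n - 2) ^ 2 / 4) := by positivity
        simpa using this
      rcases Nat.eq_zero_or_pos Aᶜ.card with hB0 | hB0
      · rw [hB0]
        have : 0 ≤ (n : ℝ) ^ 2 / 4 * ((n - 2) ^ 2 / 4) := by positivity
        simpa using this
      have ha : (1 : ℝ) ≤ A.card := by exact_mod_cast hA0
      have hb : (1 : ℝ) ≤ Aᶜ.card := by exact_mod_cast hB0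
      rw [← hc]
      set a := (A.card : ℝ)
      set b := (Aᶜ.card : ℝ)
      calc (a ^ 2 - a) * (b ^ 2 - b) = (a * b) * ((a - 1) * (b - 1)) := by ring
        _ ≤ (a + b) ^ 2 / 4 * ((a + b - 2) ^ 2 / 4) := by
            refine mul_le_mul ?_ ?_ (mul_nonneg (by linarith) (by linarith)) (by positivity)
            · nlinarith [sq_nonneg (a - b)]
            · nlinarith [sq_nonneg (a - b)]
    have h4 : 4 * (3 / 8 * (1 + 3 / ((n : ℝ) - 3)) * (n * (n - 1) * (n - 2) * (n - 3) / 24)) =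
        (n : ℝ) ^ 2 * (n - 1) * (n - 2) / 16 := by
      field_simp
      ring
    have h5 : (n : ℝ) ^ 2 / 4 * ((n - 2) ^ 2 / 4) ≤ (n : ℝ) ^ 2 * (n - 1) * (n - 2) / 16 := by
      have : (n : ℝ) ^ 2 * (n - 1) * (n - 2) / 16 - (n : ℝ) ^ 2 / 4 * ((n - 2) ^ 2 / 4) =
          (n : ℝ) ^ 2 * (n - 2) / 16 := by ring
      have h : 0 ≤ (n : ℝ) ^ 2 * (n - 2) / 16 := by positivity
      linarith
    linarith

/-! ### From balanced weights to degree stability, and the deletion dichotomy -/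

namespace KGraph

theorem linkSum_const_mul {k : ℕ} {V : Type*} [DecidableEq V] (G : KGraph (k + 1) V) (c : ℝ)
    (x : V → ℝ) (v : V) : G.linkSum (fun u => c * x u) v = c ^ k * G.linkSum x v := by
  unfold linkSum
  rw [Finset.mul_sum]
  refine Finset.sum_congr rfl fun e he => ?_
  obtain ⟨he, hv⟩ := Finset.mem_filter.mp he
  rw [Finset.prod_mul_distrib, Finset.prod_const, Finset.card_erase_of_mem hv, G.uniform e he,
    Nat.add_sub_cancel]

theorem spectralRadius_le_card {k : ℕ} {V : Type*} [Fintype V] [Nonempty V] {α : ℝ} (hα : 0 < α)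
    (G : KGraph k V) : G.spectralRadius α ≤ Nat.factorial k * Fintype.card (Finset V) := by
  refine spectralRadius_le hα G fun x hx hx1 => ?_
  have hle : ∀ v, x v ≤ 1 := fun v => by
    by_contra h
    have h1 := Real.one_lt_rpow (not_le.mp h) hα
    have h2 := Finset.single_le_sum (f := fun v => x v ^ α)
      (fun v _ => Real.rpow_nonneg (hx v) _) (Finset.mem_univ v)
    simp only [hx1] at h2
    linarith
  refine mul_le_mul_of_nonneg_left ?_ (Nat.cast_nonneg _)
  calc ∑ e ∈ G.edges, ∏ v ∈ e, x v ≤ ∑ _e ∈ G.edges, (1 : ℝ) :=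
        Finset.sum_le_sum fun e _ => Finset.prod_le_one (fun v _ => hx v) fun v _ => hle v
    _ = G.edges.card := by simp
    _ ≤ _ := by exact_mod_cast Finset.card_le_univ _

/-- If all weights of a maximizer are nearly at least average and the spectral radius is large,
then all degrees are large. -/
theorem le_degree_of_le_weights {α δ : ℝ} (hα : 1 < α) (hδ0 : 0 < δ) (hδ1 : δ < 1) {n : ℕ}
    (hn : 6 ≤ n) (G : KGraph 4 (Fin n)) {x : Fin n → ℝ} (hx : ∀ v, 0 ≤ x v)
    (hx1 : ∑ v, x v ^ α = 1) (hmax : G.lagrangian x = G.spectralRadius α)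
    (hval : balancedValue α n ≤ G.spectralRadius α)
    (hlow : ∀ v, (1 - δ) / n ≤ x v ^ α) (v : Fin n) :
    (1 / 16 * (1 - 6 / (n : ℝ)) * (1 - δ) - ((1 + δ) ^ 3 - 1)) * (n : ℝ) ^ 3 ≤ G.degree v := by
  have hα0 : 0 < α := by linarith
  have hn' : (6 : ℝ) ≤ n := by exact_mod_cast hn
  have hn0 : (0 : ℝ) < n := by linarith
  -- Rescaling makes the average of `w u ^ α` equal to `1`, so the lower bounds on all weights leave
  -- only total excess `δ * n`.
  set s : ℝ := (n : ℝ) ^ (1 / α) with hs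
  have hs0 : 0 < s := Real.rpow_pos_of_pos hn0 _
  have hsα : s ^ α = n := by
    rw [hs, ← Real.rpow_mul hn0.le, one_div_mul_cancel hα0.ne', Real.rpow_one]
  set w : Fin n → ℝ := fun u => s * x u with hw
  have hw0 : ∀ u, 0 ≤ w u := fun u => mul_nonneg hs0.le (hx u)
  have hwα : ∀ u, w u ^ α = n * x u ^ α := fun u => by
    rw [hw, Real.mul_rpow hs0.le (hx u), hsα]
  have hwlow : ∀ u, 1 - δ ≤ w u ^ α := fun u => by
    rw [hwα]
    have := hlow u
    rw [div_le_iff₀ hn0] at this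
    linarith
  have hwsum : ∑ u, w u ^ α = n := by
    simp_rw [hwα]
    rw [← Finset.mul_sum, hx1, mul_one]
  -- Pointwise `max (w u) 1 ≤ w u ^ α + δ`: above `1` because `α ≥ 1`, below `1` by the lower bound
  -- on weights.
  have hMsum : ∑ u, max (w u) 1 ≤ n * (1 + δ) := by
    calc ∑ u, max (w u) 1 ≤ ∑ u, (w u ^ α + δ) := by
          refine Finset.sum_le_sum fun u _ => max_le ?_ (by linarith [hwlow u])
          rcases le_total 1 (w u) with h | h
          · linarith [Real.self_le_rpow_of_one_le h hα.le]
          · linarith [hwlow u]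
      _ = n * (1 + δ) := by
          rw [Finset.sum_add_distrib, hwsum]
          simp
          ring
  have hdeg := G.linkSum_le_degree_add (w := w) (M := fun u => max (w u) 1) hw0
    (fun u => le_max_left _ _) (fun u => le_max_right _ _) v
  have hM3 : (∑ u, max (w u) 1) ^ 3 ≤ (n * (1 + δ)) ^ 3 := by
    gcongr
  have hΛ : 3 / 8 * (1 - 6 / (n : ℝ)) * n ^ 4 ≤ s ^ 4 * G.spectralRadius α := by
    have h1 := (le_balancedValue hα hn).trans hval
    have h2 : s ^ 4 * (n : ℝ) ^ (4 - 4 / α) = n ^ 4 := by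
      rw [hs, ← Real.rpow_natCast, ← Real.rpow_mul hn0.le, ← Real.rpow_add hn0,
        ← Real.rpow_natCast]
      congr 1
      push_cast
      ring
    calc 3 / 8 * (1 - 6 / (n : ℝ)) * n ^ 4
        = s ^ 4 * (3 / 8 * (1 - 6 / (n : ℝ)) * (n : ℝ) ^ (4 - 4 / α)) := by
          rw [← h2]
          ring
      _ ≤ _ := by gcongr
  have hwv : 0 < w v := by
    refine lt_of_le_of_ne (hw0 v) fun h => ?_
    have := hwlow v
    rw [← h, Real.zero_rpow hα0.ne'] at this
    linarith
  -- For `w v ≤ 1` lowering the exponent from `α` to `α - 1` can only increase the power.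
  have hwv1 : 1 - δ ≤ w v ^ (α - 1) := by
    rcases le_total 1 (w v) with h | h
    · linarith [Real.one_le_rpow h (by linarith : 0 ≤ α - 1)]
    · exact (hwlow v).trans (Real.rpow_le_rpow_of_exponent_ge hwv h (by linarith))
  -- The first-order condition divided by `w v > 0`, in rescaled weights.
  have hkkt : 6 * G.linkSum w v * n = s ^ 4 * G.spectralRadius α * w v ^ (α - 1) := by
    have h := G.mul_linkSum_eq hα0 (by norm_num) hx hx1 hmax v
    have h1 : G.linkSum w v = s ^ 3 * G.linkSum x v := G.linkSum_const_mul s x v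
    have h2 : w v ^ (α - 1) * w v = n * x v ^ α := by
      rw [← hwα, Real.rpow_sub_one hwv.ne', div_mul_cancel₀ _ hwv.ne']
    norm_num [Nat.factorial] at h
    refine mul_right_cancel₀ hwv.ne' ?_
    rw [mul_assoc (s ^ 4 * _), h2, h1]
    change 6 * (s ^ 3 * G.linkSum x v) * n * (s * x v) = _
    linear_combination (s ^ 4 * n / 4) * h
  have hL : 1 / 16 * (1 - 6 / (n : ℝ)) * (1 - δ) * n ^ 3 ≤ G.linkSum w v := by
    have h6 : 0 ≤ 1 - 6 / (n : ℝ) := by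
      rw [sub_nonneg, div_le_one hn0]
      exact hn'
    have h : 3 / 8 * (1 - 6 / (n : ℝ)) * n ^ 4 * (1 - δ) ≤ 6 * G.linkSum w v * n := by
      rw [hkkt]
      refine mul_le_mul hΛ hwv1 (by linarith) (le_trans (by positivity) hΛ)
    refine le_of_mul_le_mul_right ?_ (by positivity : 0 < 6 * (n : ℝ))
    linarith
  have : (n * (1 + δ)) ^ 3 - (n : ℝ) ^ 3 = ((1 + δ) ^ 3 - 1) * n ^ 3 := by ring
  linarith

/-- Under degree stability, an `𝓕`-free `4`-graph with large spectral radius and nearly balanced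
maximizer is colorable. -/
theorem exists_colorable_of_le_weights {𝓕 : KFamily 4} (hpair : IsTuranPair 𝓕 patternB4)
    (hstable : IsDegreeStable 𝓕 patternB4.Col) {α : ℝ} (hα : 1 < α) :
    ∃ δ : ℝ, 0 < δ ∧ δ < 1 ∧ ∃ N : ℕ, ∀ n ≥ N, ∀ G : KGraph 4 (Fin n), G.Free 𝓕 →
      ∀ x : Fin n → ℝ, (∀ v, 0 ≤ x v) → ∑ v, x v ^ α = 1 →
        G.lagrangian x = G.spectralRadius α → balancedValue α n ≤ G.spectralRadius α →
        (∀ v, (1 - δ) / n ≤ x v ^ α) → G.Colorable patternB4 := by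
  obtain ⟨ε, hε, N, hN⟩ := hstable
  rw [hpair.turanDensity_eq] at hN
  -- With `δ ≤ 1 / 2` the loss caused by `δ` is at most `δ / 16 + 7 * δ`, and `1 / n ≤ ε` bounds the
  -- remaining loss by `6 * ε / 16`. Together these stay below `ε`.
  have hδ : 0 < min (ε / 16) (1 / 2) := by positivity
  refine ⟨min (ε / 16) (1 / 2), hδ, (min_le_right _ _).trans_lt (by norm_num),
    max N (max 6 ⌈1 / ε⌉₊), fun n hn G hG x hx hx1 hmax hval hlow => ?_⟩
  have hnN : N ≤ n := (le_max_left _ _).trans hn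
  have hn6 : 6 ≤ n := (le_max_left _ _).trans ((le_max_right _ _).trans hn)
  have hnε : 1 / ε ≤ n := (Nat.le_ceil _).trans
    (by exact_mod_cast (le_max_right _ _).trans ((le_max_right _ _).trans hn))
  have hn0 : (0 : ℝ) < n := by exact_mod_cast (by omega : 0 < n)
  have : Nonempty (Fin n) := ⟨⟨0, by omega⟩⟩
  refine hN n hnN G hG ?_
  obtain ⟨v, hv⟩ : ∃ v, G.degree v = G.minDegree := exists_eq_ciInf_of_finite
  rw [← hv]
  refine le_trans ?_ (G.le_degree_of_le_weights hα hδ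
    ((min_le_right _ _).trans_lt (by norm_num)) hn6 hx hx1 hmax hval hlow v)
  set δ := min (ε / 16) (1 / 2)
  have h1 : δ ≤ ε / 16 := min_le_left _ _
  have h2 : δ ≤ 1 / 2 := min_le_right _ _
  have h3 : 1 / (n : ℝ) ≤ ε := by
    rw [div_le_iff₀ hε] at hnε
    rw [div_le_iff₀ hn0]
    linarith
  have h4 : (0 : ℝ) < 1 / n := by positivity
  norm_num [Nat.factorial]
  refine mul_le_mul_of_nonneg_right ?_ (by positivity)
  rw [show (6 : ℝ) / n = 6 * (1 / n) by ring]
  have h5 : (1 + δ) ^ 3 - 1 ≤ 7 * δ := by nlinarith [mul_pos hδ hδ]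
  have h6 : 1 - 6 * (1 / (n : ℝ)) - δ ≤ (1 - 6 * (1 / (n : ℝ))) * (1 - δ) := by
    nlinarith [mul_pos h4 hδ]
  nlinarith

/-- An `𝓕`-free `4`-graph with spectral radius at least that of `B₄(m+1)` either is colorable with
a positive maximizer, or has a vertex whose deletion increases the ratio to the extremal value. -/
theorem exists_colorable_or_deleteVertex {𝓕 : KFamily 4} (hpair : IsTuranPair 𝓕 patternB4)
    (hstable : IsDegreeStable 𝓕 patternB4.Col) {α : ℝ} (hα : 1 < α) :
    ∃ c > 0, ∃ N ≥ 4, ∀ m ≥ N, ∀ G : KGraph 4 (Fin (m + 1)), G.Free 𝓕 →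
      balancedValue α (m + 1) ≤ G.spectralRadius α →
      (G.Colorable patternB4 ∧ ∃ x : Fin (m + 1) → ℝ, (∀ v, 0 < x v) ∧ ∑ v, x v ^ α = 1 ∧
        G.lagrangian x = G.spectralRadius α) ∨
      ∃ v, G.spectralRadius α / balancedValue α (m + 1) * (1 + c / ((m : ℝ) + 1)) ≤
        (G.deleteVertex v).spectralRadius α / balancedValue α m := by
  obtain ⟨δ, hδ0, hδ1, N₁, hN₁⟩ := exists_colorable_of_le_weights hpair hstable hα
  obtain ⟨c, hc, N₂, hN₂⟩ := eventually_gain hα hδ0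
  refine ⟨c, hc, max 4 (max N₁ N₂), le_max_left _ _, fun m hm G hG hval => ?_⟩
  have hm4 : 4 ≤ m := (le_max_left _ _).trans hm
  have hm1 : N₁ ≤ m := (le_max_left _ _).trans ((le_max_right _ _).trans hm)
  have hm2 : N₂ ≤ m := (le_max_right _ _).trans ((le_max_right _ _).trans hm)
  have hα0 : 0 < α := by linarith
  obtain ⟨x, hx, hx1, hmax⟩ := G.exists_maximizer hα0
  by_cases hlow : ∀ v, (1 - δ) / ((m + 1 : ℕ) : ℝ) ≤ x v ^ α
  · refine Or.inl ⟨hN₁ (m + 1) (by omega) G hG x hx hx1 hmax hval hlow, x, fun v => ?_, hx1, hmax⟩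
    refine lt_of_le_of_ne (hx v) fun h => ?_
    have h1 := hlow v
    rw [← h, Real.zero_rpow hα0.ne'] at h1
    have : 0 < (1 - δ) / ((m + 1 : ℕ) : ℝ) := div_pos (by linarith) (by positivity)
    linarith
  · right
    push Not at hlow
    obtain ⟨v, hv⟩ := hlow
    refine ⟨v, ?_⟩
    have hy0 : 0 ≤ x v ^ α := Real.rpow_nonneg (hx v) _
    push_cast at hv
    have hgain := hN₂ m hm2 (x v ^ α) hy0 hv.le
    have hdel := G.spectralRadius_mul_le_deleteVertex hα0 (by norm_num) (by omega) hx hx1 hmax v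
    have hratio := balancedValue_mul_le hα (m := m) (by omega)
    have hb0 := balancedValue_pos (α := α) hm4
    have hb1 := balancedValue_pos (α := α) (n := m + 1) (by omega)
    have hy1 : x v ^ α < 1 := by
      refine hv.trans_le ?_
      rw [div_le_one (by positivity)]
      have : (0 : ℝ) ≤ m := Nat.cast_nonneg m
      linarith
    push_cast at hdel
    set y := x v ^ α
    have hq : 0 < (1 - y) ^ (4 / α) := Real.rpow_pos_of_pos (by linarith) _
    set q := (1 - y) ^ (4 / α)
    set R := (1 + 2 / ((m : ℝ) + 1)) ^ (2 - 2 / α)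
    have hR : 0 < R := by positivity
    set lam := G.spectralRadius α
    set lam' := (G.deleteVertex v).spectralRadius α
    have hlam : 0 < lam := hb1.trans_le hval
    rw [div_mul_eq_mul_div, div_le_div_iff₀ hb1 hb0]
    refine le_of_mul_le_mul_right ?_ hq
    have hlam' : 0 ≤ lam' := by
      have : Nonempty (Fin m) := ⟨⟨0, by omega⟩⟩
      exact (G.deleteVertex v).spectralRadius_nonneg hα0
    calc lam * (1 + c / ((m : ℝ) + 1)) * balancedValue α m * q
        = lam * balancedValue α m * ((1 + c / ((m : ℝ) + 1)) * q) := by ring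
      _ ≤ lam * balancedValue α m * ((1 - 4 * y) * R) := by gcongr
      _ = (lam * (1 - 4 * y)) * (balancedValue α m * R) := by ring
      -- Zeroing the light coordinate loses `4 * lam * y`; renormalizing the rest contributes `q`.
      _ ≤ (lam' * q) * (balancedValue α m * R) := by gcongr
      _ ≤ (lam' * q) * balancedValue α (m + 1) := by gcongr
      _ = lam' * balancedValue α (m + 1) * q := by ring

end KGraph

/-! ### Iterated deletion and the main theorem -/

theorem theorem3p7 (𝓕 : KFamily 4) (hpair : IsTuranPair 𝓕 patternB4)
    (hstable : IsDegreeStable 𝓕 patternB4.Col) (α : ℝ) (hα : 1 < α) :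
    ∃ n₀ : ℕ, ∀ n > n₀, ∀ G : KGraph 4 (Fin n), G.Free 𝓕 →
      G.spectralRadius α ≤ (B4 n).spectralRadius α ∧
      (G.spectralRadius α = (B4 n).spectralRadius α ↔ G.Iso (B4 n)) := by
  have hα0 : 0 < α := by linarith
  obtain ⟨c, hc, N, hN4, hN⟩ := KGraph.exists_colorable_or_deleteVertex hpair hstable hα
  set C : ℝ := Nat.factorial 4 * Fintype.card (Finset (Fin N)) / balancedValue α N
  -- The maximum with `1` closes the induction: a ratio above `1` excludes colorability, so some
  -- deletion yields a larger ratio at the preceding order.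
  have bound : ∀ n ≥ N, ∀ G : KGraph 4 (Fin n), G.Free 𝓕 →
      G.spectralRadius α / balancedValue α n ≤
        max 1 (C - c * ∑ i ∈ Finset.Ico N n, 1 / ((i : ℝ) + 1)) := by
    intro n hn
    induction n, hn using Nat.le_induction with
    | base =>
      intro G _
      have : Nonempty (Fin N) := ⟨⟨0, by omega⟩⟩
      refine le_max_of_le_right ?_
      rw [Finset.Ico_self, Finset.sum_empty, mul_zero, sub_zero]
      exact div_le_div_of_nonneg_right (G.spectralRadius_le_card hα0) (balancedValue_pos hN4).le
    | succ m hm ih =>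
      intro G hG
      have hb := balancedValue_pos (α := α) (n := m + 1) (by omega)
      by_contra! hlt
      obtain ⟨h1, h2⟩ := max_lt_iff.mp hlt
      have hval : balancedValue α (m + 1) < G.spectralRadius α := by
        rwa [one_lt_div hb] at h1
      rcases hN m hm G hG hval.le with ⟨hcol, -⟩ | ⟨v, hv⟩
      · exact absurd (hcol.spectralRadius_le hα (by omega)) (not_le.mpr hval)
      · have h3 := ih (G.deleteVertex v) (hG.deleteVertex v)
        have hcm : 0 < c / ((m : ℝ) + 1) := by positivity
        -- Since the ratio exceeds `1`, the multiplicative gain is at least an additive one of `c /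
        -- (m + 1)`.
        have h4 : G.spectralRadius α / balancedValue α (m + 1) + c / ((m : ℝ) + 1) ≤
            max 1 (C - c * ∑ i ∈ Finset.Ico N m, 1 / ((i : ℝ) + 1)) := by
          refine le_trans ?_ (hv.trans h3)
          nlinarith
        rw [Finset.sum_Ico_succ_top hm, mul_add, mul_one_div] at h2
        rcases le_max_iff.mp h4 with h5 | h5 <;> linarith
  have hdiv : Tendsto (fun n : ℕ => ∑ i ∈ Finset.range n, 1 / ((i : ℝ) + 1)) atTop atTop :=
    Real.tendsto_sum_range_one_div_nat_succ_atTop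
  -- Beyond `N'` the harmonic tail from `N` exceeds `(C - 1) / c`, so the second term of the maximum
  -- is at most `1`.
  obtain ⟨N', hN'⟩ := eventually_atTop.mp (hdiv.eventually_ge_atTop
    ((C - 1) / c + ∑ i ∈ Finset.range N, 1 / ((i : ℝ) + 1)))
  have upper : ∀ n ≥ max N N', ∀ G : KGraph 4 (Fin n), G.Free 𝓕 →
      G.spectralRadius α / balancedValue α n ≤ 1 := by
    intro n hn G hG
    have hnN : N ≤ n := (le_max_left _ _).trans hn
    refine (bound n hnN G hG).trans (max_le le_rfl ?_)
    have h := hN' n ((le_max_right _ _).trans hn)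
    rw [Finset.sum_Ico_eq_sub _ hnN]
    have h2 : (C - 1) / c ≤ ∑ i ∈ Finset.range n, 1 / ((i : ℝ) + 1) -
        ∑ i ∈ Finset.range N, 1 / ((i : ℝ) + 1) := by linarith
    rw [div_le_iff₀ hc] at h2
    linarith
  refine ⟨max N N', fun n hn G hG => ?_⟩
  obtain ⟨m, rfl⟩ : ∃ m, n = m + 1 := ⟨n - 1, by omega⟩
  -- The strict inequality `n > n₀` keeps the order `m = n - 1` within the range of `upper`, as the
  -- equality case needs after a deletion.
  have hm : max N N' ≤ m := by omega
  have hmN : N ≤ m := (le_max_left _ _).trans hm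
  have hb := balancedValue_pos (α := α) (n := m + 1) (by omega)
  rw [spectralRadius_B4 hα (by omega)]
  have hle := upper (m + 1) hn.le G hG
  rw [div_le_one hb] at hle
  refine ⟨hle, fun heq => ?_, fun hiso => ?_⟩
  · rcases hN m hmN G hG heq.ge with ⟨hcol, x, hx, hx1, hmax⟩ | ⟨v, hv⟩
    · exact hcol.iso_B4 hα (by omega) hx hx1 (hmax.trans heq)
    · have h := upper m hm (G.deleteVertex v) (hG.deleteVertex v)
      rw [heq, div_self hb.ne', one_mul] at hv
      have : 0 < c / ((m : ℝ) + 1) := by positivity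
      linarith
  · rw [hiso.spectralRadius_eq, spectralRadius_B4 hα (by omega)]
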